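/- Let $\Pi$ be an irreducible, reduced, crystallographic root system spanning a Euclidean space $V\cong\mathbb R^n$ with scalar product $\langle\cdot,\cdot\rangle$, with simple roots $\alpha_1,\dots,\alpha_n$ and highest root $\xi$, normalized by $\langle\xi,\xi\rangle=2$. Put $\alpha^\vee=2\alpha/\langle\alpha,\alpha\rangle$, $Q^\vee=\sum_i\mathbb Z\alpha_i^\vee$, $P=\{\omega\in V:\langle\omega,q\rangle\in\mathbb Z\ \forall q\in Q^\vee\}$, $d=\det(\langle\alpha_i^\vee,\alpha_j^\vee\rangle)_{i,j}$, and define the comarks by $q_0=1$ and $\xi=\sum_{i=1}^n q_i\alpha_i^\vee$; let $g=\sum_{i=0}^n q_i$. Let $W$ be the Weyl group, $W^{\mathrm{aff}}=T(Q^\vee)\rtimes W$ the affine Weyl group acting on $V$, $\psi:W^{\mathrm{aff}}\to W$ the projection, $r_i=r_{\alpha_i}$ for $1\le i\le n$ and $r_0a=r_\xi a+\xi^\vee$. Let $F=\{a\in V:\langle a,\alpha_i\rangle\ge 0\ (1\le i\le n),\ \langle a,\xi\rangle\le 1\}$ be the fundamental domain of $W^{\mathrm{aff}}$, and for real $M>0$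 let $h_M(a)=|\mathrm{Stab}_{W^{\mathrm{aff}}}(a/M)|$. For a homomorphism $\sigma:W\to\{\pm1\}$ put $$F^\sigma=\{a\in F:\ \sigma(\psi(\mathrm{Stab}_{W^{\mathrm{aff}}}(a)))=\{1\}\},\qquad q^\sigma=\sum_{0\le i\le n,\ \sigma(\psi(r_i))=-1}q_i,$$ $$\Lambda^\sigma_{P,M}=P\cap MF^\sigma,\qquad \phi^\sigma_\lambda(a)=\sum_{w\in W}\sigma(w)e^{2\pi i\langle w\lambda,a\rangle}.$$ Then for every homomorphism $\sigma:W\to\{\pm1\}$ and every integer $k\ge1$ the set $\Lambda^\sigma_{P,k+q^\sigma}$ is finite, and the matrix with entries $$S^\sigma_{\lambda,\mu}=\frac{i^{|\Pi|/2}\,\phi^\sigma_\lambda\!\left(\frac{-\mu}{k+q^\sigma}\right)}{\sqrt{d\,(k+q^\sigma)^n\,h_{k+q^\sigma}(\lambda)\,h_{k+q^\sigma}(\mu)}},\qquad \lambda,\mu\in\Lambda^\sigma_{P,k+q^\sigma},$$ is unitary and symmetric. Moreover, for $\sigma=\sigma^e$, $\sigma^e(w)=\det w$, it coincides with the Kac–Peterson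 modular $S$-matrix at level $k$: let $\rho$ be half the sum of the positive roots, $\Pi_+$ the set of positive roots, and $P_+^k=\{\lambda\in P:\langle\lambda,\alpha_i^\vee\rangle\ge0\ (1\le i\le n),\ \langle\lambda,\xi^\vee\rangle\le k\}$ the set of (horizontal parts of) integrable highest weights at level $k$. Then $\lambda\mapsto\lambda+\rho$ is a bijection $P_+^k\to\Lambda^{\sigma^e}_{P,k+q^{\sigma^e}}$, and for all $\lambda,\mu\in P_+^k$ $$S^{\sigma^e}_{\lambda+\rho,\mu+\rho}=i^{|\Pi_+|}\,|P/Q^\vee|^{-1/2}\,(k+g)^{-n/2}\sum_{w\in W}\det(w)\,\exp\!\left(-\frac{2\pi i\,\langle w(\lambda+\rho),\mu+\rho\rangle}{k+g}\right).$$ -/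

import Mathlib

open scoped Pointwise

noncomputable section

namespace OrbitFunction

variable {ι V : Type*} [NormedAddCommGroup V] [InnerProductSpace ℝ V]

/-- Root system in a Euclidean space `V`, where the coroots are taken in `V` itself: the pairing of
roots with coroots is the scalar product, and `α^∨ = 2 α / ⟨α, α⟩`. -/
class IsEuclidean (P : RootPairing ι ℝ V V) : Prop where
  toLinearMap_apply : ∀ x y : V, P.toLinearMap x y = inner ℝ x y
  coroot_eq : ∀ i, P.coroot i = (2 / inner ℝ (P.root i) (P.root i)) • P.root i

variable (P : RootPairing ι ℝ V V)

section helpers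

variable {P}

lemma reflection_eq [IsEuclidean P] (i : ι) (x : V) :
    P.reflection i x = x - inner ℝ x (P.coroot i) • P.root i := by
  rw [RootPairing.reflection_apply, ← IsEuclidean.toLinearMap_apply (P := P)]
  rfl

lemma inner_reflection [IsEuclidean P] (i : ι) (x y : V) :
    inner ℝ (P.reflection i x) (P.reflection i y) = inner ℝ x y := by
  have h0 : inner ℝ (P.root i) (P.root i) ≠ 0 := by
    rw [Ne, inner_self_eq_zero]
    exact P.ne_zero i
  simp only [reflection_eq, IsEuclidean.coroot_eq (P := P) i, inner_sub_left, inner_sub_right,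
    real_inner_smul_left, real_inner_smul_right, real_inner_comm y (P.root i)]
  generalize inner ℝ (P.root i) (P.root i) = c at h0 ⊢
  field_simp
  ring

lemma inner_smul_smul [IsEuclidean P] (w : P.weylGroup) (x y : V) :
    inner ℝ (w • x) (w • y) = inner ℝ x y := by
  revert x y
  obtain ⟨w, hw⟩ := w
  induction hw using RootPairing.weylGroup.induction with
  | mem i => exact fun x y => inner_reflection i x y
  | one => exact fun x y => rfl
  | mul g₁ g₂ hg₁ hg₂ h₁ h₂ =>
    intro x y
    rw [← Submonoid.mk_mul_mk _ _ _ hg₁ hg₂, mul_smul, mul_smul, h₁, h₂]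

lemma smul_coroot [IsEuclidean P] (w : P.weylGroup) (i : ι) :
    w • P.coroot i = P.coroot (P.weylGroupToPerm w i) := by
  rw [IsEuclidean.coroot_eq, IsEuclidean.coroot_eq, smul_comm, ← P.weylGroup_apply_root,
    inner_smul_smul]

lemma smul_mem_corootSpan [IsEuclidean P] (w : P.weylGroup) {q : V} (hq : q ∈ P.corootSpan ℤ) :
    w • q ∈ P.corootSpan ℤ := by
  induction hq using Submodule.span_induction with
  | mem x hx =>
    obtain ⟨i, rfl⟩ := hx
    rw [smul_coroot]
    exact Submodule.subset_span ⟨_, rfl⟩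
  | zero => simp
  | add x y _ _ hx hy => rw [smul_add]; exact add_mem hx hy
  | smul n x _ hx => rw [smul_comm]; exact Submodule.smul_mem _ n hx

instance [Finite ι] [P.IsRootSystem] : Finite P.weylGroup := by
  refine Finite.of_injective (fun w : P.weylGroup => P.weylGroupToPerm w) ?_
  intro w₁ w₂ h
  apply Subtype.ext
  apply RootPairing.Equiv.weightHom_injective P
  apply LinearEquiv.toLinearMap_injective
  refine LinearMap.ext_on_range (v := P.root) RootPairing.IsRootSystem.span_root_eq_top ?_
  intro i
  have h₁ := P.weylGroup_apply_root w₁ i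
  have h₂ := P.weylGroup_apply_root w₂ i
  have h' : P.weylGroupToPerm w₁ = P.weylGroupToPerm w₂ := h
  rw [← h', ← h₁] at h₂
  exact h₂.symm

instance [Finite ι] [P.IsRootSystem] : Fintype P.weylGroup := Fintype.ofFinite _

variable (P) in
/-- The determinant of an element of the Weyl group, as a linear map of `V`. -/
def detHom : P.weylGroup →* ℝˣ :=
  LinearEquiv.det.comp ((RootPairing.Equiv.weightHom P).comp P.weylGroup.subtype)

lemma detHom_eq_one_or (w : P.weylGroup) : detHom P w = 1 ∨ detHom P w = -1 := by
  obtain ⟨w, hw⟩ := w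
  induction hw using RootPairing.weylGroup.induction with
  | mem i =>
    have h : RootPairing.weylGroup.ofIdx P i * RootPairing.weylGroup.ofIdx P i = 1 := by
      apply Subtype.ext
      change RootPairing.Equiv.reflection P i * RootPairing.Equiv.reflection P i = 1
      rw [mul_eq_one_iff_inv_eq, RootPairing.Equiv.reflection_inv P i]
    have h' := congrArg (fun g => (detHom P g : ℝ)) h
    simp only [map_mul, map_one, Units.val_mul, Units.val_one] at h'
    exact (mul_self_eq_one_iff.mp h').imp (fun h => Units.ext h) (fun h => Units.ext h)
  | one => exact Or.inl (map_one (detHom P))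
  | mul g₁ g₂ hg₁ hg₂ h₁ h₂ =>
    rw [← Submonoid.mk_mul_mk _ _ _ hg₁ hg₂, map_mul]
    rcases h₁ with h₁ | h₁ <;> rcases h₂ with h₂ | h₂ <;> rw [h₁, h₂] <;> simp

end helpers

/-! ### Weight lattice, affine Weyl group -/

/-- The weight lattice: the `ℤ`-dual of the coroot lattice `Q^∨ = P.corootSpan ℤ`. -/
def weightLattice : AddSubgroup V where
  carrier := {x | ∀ q ∈ P.corootSpan ℤ, ∃ z : ℤ, inner ℝ x q = z}
  zero_mem' := fun q _ => ⟨0, by simp⟩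
  add_mem' := by
    intro x y hx hy q hq
    obtain ⟨a, ha⟩ := hx q hq
    obtain ⟨c, hc⟩ := hy q hq
    exact ⟨a + c, by rw [inner_add_left, ha, hc]; push_cast; rfl⟩
  neg_mem' := by
    intro x hx q hq
    obtain ⟨a, ha⟩ := hx q hq
    exact ⟨-a, by rw [inner_neg_left, ha]; push_cast; rfl⟩

/-- The action of the Weyl group on the coroot lattice by automorphisms. -/
def corootAction [IsEuclidean P] : P.weylGroup →* MulAut (Multiplicative (P.corootSpan ℤ)) where
  toFun w :=
    { toFun := fun q => .ofAdd ⟨w • (q.toAdd : V), smul_mem_corootSpan w q.toAdd.2⟩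
      invFun := fun q => .ofAdd ⟨w⁻¹ • (q.toAdd : V), smul_mem_corootSpan w⁻¹ q.toAdd.2⟩
      left_inv := fun q => by simp
      right_inv := fun q => by simp
      map_mul' := fun q r => by
        apply Multiplicative.toAdd.injective
        apply Subtype.ext
        simp }
  map_one' := by ext q; simp
  map_mul' w w' := by ext q; simp [mul_smul]

/-- The affine Weyl group `W^aff = T(Q^∨) ⋊ W`. -/
abbrev AffineWeylGroup [IsEuclidean P] : Type _ :=
  Multiplicative (P.corootSpan ℤ) ⋊[corootAction P] P.weylGroup

/-- `T(q) w` acts on `V` by `a ↦ w a + q`. -/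
instance [IsEuclidean P] : MulAction (AffineWeylGroup P) V where
  smul g a := g.right • a + (g.left.toAdd : V)
  one_smul a := by
    change (1 : P.weylGroup) • a + ((0 : P.corootSpan ℤ) : V) = a
    simp
  mul_smul g g' a := by
    change (g.right * g'.right) • a + ((g.left.toAdd : V) + g.right • (g'.left.toAdd : V)) =
      g.right • (g'.right • a + (g'.left.toAdd : V)) + (g.left.toAdd : V)
    rw [mul_smul, smul_add]
    abel

/-- The retraction homomorphism `ψ : W^aff → W`. -/
def retraction [IsEuclidean P] : AffineWeylGroup P →* P.weylGroup :=
  SemidirectProduct.rightHom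

/-- `h_M(a)`, the order of the stabilizer of `a / M` in the affine Weyl group. -/
def stabOrder [IsEuclidean P] (M : ℝ) (a : V) : ℕ :=
  Nat.card (MulAction.stabilizer (AffineWeylGroup P) (M⁻¹ • a))

/-- The sign homomorphism `σ^e`, `σ^e(w) = det w`. -/
def detSign : P.weylGroup →* ℤˣ where
  toFun w := open Classical in if detHom P w = 1 then 1 else -1
  map_one' := by simp
  map_mul' w w' := by
    have hne : (-1 : ℝˣ) ≠ 1 := fun h => by
      have := congrArg Units.val h
      norm_num at this
    rcases detHom_eq_one_or w with h | h <;> rcases detHom_eq_one_or w' with h' | h' <;>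
      simp [h, h', hne]

lemma detSign_eq_det (w : P.weylGroup) : ((detSign P w : ℤ) : ℝ) = detHom P w := by
  have hne : (-1 : ℝˣ) ≠ 1 := fun h => by
    have := congrArg Units.val h
    norm_num at this
  rcases detHom_eq_one_or w with h | h <;> simp [detSign, h, hne]

variable {P}

/-! ### Highest root, comarks, fundamental domain -/

/-- `P.root ξ` is the highest root: every other root is obtained from it by subtracting
a combination of simple roots with nonnegative integer coefficients. -/
def IsHighestRoot (b : P.Base) (ξ : ι) : Prop :=
  ∀ i, P.root ξ - P.root i ∈ AddSubmonoid.closure (P.root '' (b.support : Set ι))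

/-- The generators `r_0, r_1, …, r_n` of the affine Weyl group; `none` stands for the index `0`,
with `r_0 a = r_ξ a + ξ^∨`. -/
def generator [IsEuclidean P] (b : P.Base) (ξ : ι) : Option b.support → AffineWeylGroup P
  | none => ⟨.ofAdd ⟨P.coroot ξ, Submodule.subset_span ⟨ξ, rfl⟩⟩, RootPairing.weylGroup.ofIdx P ξ⟩
  | some i => ⟨1, RootPairing.weylGroup.ofIdx P i⟩

/-- The comarks `q_0 = 1, q_1, …, q_n`: the coordinates of the highest root in the basis of
simple coroots. -/
def comark [P.IsRootSystem] (b : P.Base) (ξ : ι) : Option b.support → ℝ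
  | none => 1
  | some i => b.toCoweightBasis.repr (P.root ξ) i

/-- The dual Coxeter number. -/
def dualCoxeter [P.IsRootSystem] (b : P.Base) (ξ : ι) : ℝ := ∑ i, comark b ξ i

open Classical in
/-- `q^σ`, the sum of the comarks over the generators `r_i` with `σ (ψ r_i) = -1`. -/
def qSigma [P.IsRootSystem] [IsEuclidean P] (b : P.Base) (ξ : ι) (σ : P.weylGroup →* ℤˣ) : ℝ :=
  ∑ i with σ (retraction P (generator b ξ i)) = -1, comark b ξ i

/-- The fundamental domain `F` of the affine Weyl group. In the coordinates `y_i = ⟨a, α_i⟩` with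
respect to the fundamental coweights and `y_0 = 1 - ⟨a, ξ⟩ = 1 - ∑ m_i y_i`, it is given by
`y_0, …, y_n ≥ 0`. -/
def fundamentalDomain (b : P.Base) (ξ : ι) : Set V :=
  {a | (∀ i ∈ b.support, 0 ≤ inner ℝ a (P.root i)) ∧ inner ℝ a (P.root ξ) ≤ 1}

/-- `F^σ`, the points `a` of `F` such that `σ ∘ ψ` is trivial on the stabilizer of `a`. -/
def fundamentalDomainSigma [IsEuclidean P] (b : P.Base) (ξ : ι) (σ : P.weylGroup →* ℤˣ) : Set V :=
  {a ∈ fundamentalDomain b ξ |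
    ∀ g ∈ MulAction.stabilizer (AffineWeylGroup P) a, σ (retraction P g) = 1}

/-- `Λ^σ_{P,M}`, the weights in `M F^σ`. -/
def labels [IsEuclidean P] (b : P.Base) (ξ : ι) (σ : P.weylGroup →* ℤˣ) (M : ℝ) : Set V :=
  (weightLattice P : Set V) ∩ M • fundamentalDomainSigma b ξ σ

/-! ### Orbit functions and the matrices `S^σ` -/

/-- The orbit function `φ^σ_λ (a) = ∑_w σ(w) exp (2πi ⟨w λ, a⟩)`. -/
def orbitFunction [Finite ι] [P.IsRootSystem] (σ : P.weylGroup →* ℤˣ) (l a : V) : ℂ :=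
  ∑ w : P.weylGroup,
    ((σ w : ℤ) : ℂ) * Complex.exp (2 * Real.pi * Complex.I * (inner ℝ (w • l) a : ℝ))

open Classical in
/-- The Gram determinant of the simple coroots. -/
def gramDet (b : P.Base) : ℝ :=
  (Matrix.of fun i j : b.support => inner ℝ (P.coroot i) (P.coroot j)).det

/-- The matrix `S^σ` at level `k`. -/
def sMatrix [Finite ι] [P.IsRootSystem] [IsEuclidean P] (b : P.Base) (ξ : ι)
    (σ : P.weylGroup →* ℤˣ) (k : ℕ) :
    Matrix (labels b ξ σ (k + qSigma b ξ σ)) (labels b ξ σ (k + qSigma b ξ σ)) ℂ :=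
  let M : ℝ := k + qSigma b ξ σ
  Matrix.of fun l m =>
    Complex.I ^ (Nat.card ι / 2) * orbitFunction σ (l : V) (-(M⁻¹ • (m : V))) /
      (Real.sqrt (gramDet b * M ^ Module.finrank ℝ V * stabOrder P M (l : V) *
        stabOrder P M (m : V)) : ℝ)

/-! ### The Kac–Peterson matrix -/

/-- The horizontal parts `P_+^k` of the integrable highest weights at level `k` of the untwisted
affine algebra. -/
def integrableWeights (b : P.Base) (ξ : ι) (k : ℕ) : Set V :=
  {l | l ∈ weightLattice P ∧ (∀ i ∈ b.support, 0 ≤ inner ℝ l (P.coroot i)) ∧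
    inner ℝ l (P.coroot ξ) ≤ k}

/-- The Weyl vector, half the sum of the positive roots. -/
def weylVector (b : P.Base) : V := (1 / 2 : ℝ) • ∑ᶠ i ∈ {i | b.IsPos i}, P.root i

/-- The Kac–Peterson modular `S`-matrix at level `k`, with rows and columns indexed by `P_+^k`:
`i^{|Π₊|} |P/Q^∨|^{-1/2} (k+g)^{-n/2} ∑_w det(w) exp (-2πi ⟨w (λ+ρ), μ+ρ⟩ / (k+g))`. -/
def kacPeterson [Finite ι] [P.IsRootSystem] (b : P.Base) (ξ : ι) (k : ℕ) :
    Matrix (integrableWeights b ξ k) (integrableWeights b ξ k) ℂ :=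
  Matrix.of fun l m =>
    Complex.I ^ (Nat.card {i // b.IsPos i}) *
      (((P.corootSpan ℤ).toAddSubgroup.relIndex (weightLattice P) : ℝ) ^ (-1 / 2 : ℝ) : ℝ) *
      ((k + dualCoxeter b ξ) ^ (-(Module.finrank ℝ V : ℝ) / 2) : ℝ) *
      ∑ w : P.weylGroup,
        ((detHom P w : ℝ) : ℂ) *
          Complex.exp (-2 * Real.pi * Complex.I *
            (inner ℝ (w • ((l : V) + weylVector b)) ((m : V) + weylVector b) /
              (k + dualCoxeter b ξ) : ℝ))

end OrbitFunction

end

open scoped Pointwise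

noncomputable section

namespace OrbitFunction

/-! ### Euclidean root systems: pairings, integrality, the cone of simple roots, the highest root.
-/

section Basic

variable {ι V : Type*} [NormedAddCommGroup V] [InnerProductSpace ℝ V]

/-! Put N = k + q^σ. The normalization gives ξ = ξ^∨, so the comarks are nonnegative integers and N
is a positive integer. The orbit Wξ^∨ spans Q^∨, so Q^∨ ⊆ P, and P/NQ^∨ is a finite group of order d
N^n. Its characters μ ↦ exp(2πi⟨ν,μ⟩/N), ν ∈ P, are trivial exactly for ν ∈ NQ^∨
(`weightChar_eq_zero_iff`).

Summing φ_λ times the conjugate of φ_λ' over P/NQ^∨ therefore leaves only the pairs (w, w') with wλ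
≡ w'λ' mod NQ^∨. As F is a strict fundamental domain of W^aff, this forces λ = λ' and puts w⁻¹w' in
ψ(Stab(λ/N)), on which σ is trivial because λ ∈ NF^σ. The value is d N^n |W| h_N(λ)
(`sum_orbitFunction_mul_orbitFunction`). The summand is also W-invariant, so the sum folds to |W|
times a sum over P ∩ NF with weights 1/h_N (`sum_weightRep_eq`), and the orbit functions vanish at
the points outside NF^σ (`orbitFunction_eq_zero`). Comparing the two values gives unitarity;
symmetry is the substitution w ↦ w⁻¹.

That F meets every orbit follows by minimizing the distance to an interior point; that it meets each
orbit only once follows from the exchange property for words in r_0, …, r_n (`smul_eq_of_mem`). The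
geometric input is that each wall has a point on no other affine root hyperplane
(`exists_wall_point`).

For σ = det every generator has sign −1, so q^σ = g, and F^σ is the open alcove, whose points have
trivial stabilizers. Since ⟨ρ,α_i^∨⟩ = 1 and ⟨ρ,ξ⟩ = g − 1, integrality turns the strict
inequalities for λ + ρ into the weak ones that define P_+^k. -/

lemma exists_inner_basis_eq {κ : Type*} [FiniteDimensional ℝ V] (v : Module.Basis κ ℝ V)
    (y : κ → ℝ) : ∃ x : V, ∀ i, inner ℝ x (v i) = y i := by
  refine ⟨(InnerProductSpace.toDual ℝ V).symm (LinearMap.toContinuousLinearMap (v.constr ℝ y)),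
    fun i => ?_⟩
  rw [InnerProductSpace.toDual_symm_apply]
  simp

variable {P : RootPairing ι ℝ V V}

lemma ofIdx_smul_eq [IsEuclidean P] (i : ι) (x : V) :
    RootPairing.weylGroup.ofIdx P i • x = x - inner ℝ x (P.coroot i) • P.root i :=
  reflection_eq i x

lemma inner_root_self_pos (P : RootPairing ι ℝ V V) (i : ι) :
    0 < inner ℝ (P.root i) (P.root i) :=
  real_inner_self_pos.2 (P.ne_zero i)

lemma inner_coroot [IsEuclidean P] (i : ι) (x : V) :
    inner ℝ x (P.coroot i) = 2 / inner ℝ (P.root i) (P.root i) * inner ℝ x (P.root i) := by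
  rw [IsEuclidean.coroot_eq, real_inner_smul_right]

lemma ofIdx_smul_eq' [IsEuclidean P] (i : ι) (x : V) :
    RootPairing.weylGroup.ofIdx P i • x = x - inner ℝ x (P.root i) • P.coroot i := by
  rw [ofIdx_smul_eq, inner_coroot, IsEuclidean.coroot_eq, smul_smul, mul_comm]

lemma inner_root_coroot [IsEuclidean P] (i j : ι) :
    inner ℝ (P.root i) (P.coroot j) = P.pairing i j := by
  rw [← IsEuclidean.toLinearMap_apply (P := P)]
  rfl

lemma exists_inner_root_coroot_eq_int [IsEuclidean P] [P.IsCrystallographic] (i j : ι) :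
    ∃ z : ℤ, inner ℝ (P.root i) (P.coroot j) = z :=
  ⟨P.pairingIn ℤ i j, by rw [inner_root_coroot, ← P.algebraMap_pairingIn ℤ]; rfl⟩

lemma exists_inner_root_eq_int [IsEuclidean P] [P.IsCrystallographic] (i : ι) {q : V}
    (hq : q ∈ P.corootSpan ℤ) : ∃ z : ℤ, inner ℝ q (P.root i) = z := by
  induction hq using Submodule.span_induction with
  | mem x hx =>
    obtain ⟨j, rfl⟩ := hx
    rw [real_inner_comm]
    exact exists_inner_root_coroot_eq_int i j
  | zero => exact ⟨0, by simp⟩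
  | add x y _ _ hx hy =>
    obtain ⟨a, ha⟩ := hx
    obtain ⟨c, hc⟩ := hy
    exact ⟨a + c, by rw [inner_add_left, ha, hc]; push_cast; rfl⟩
  | smul n x _ hx =>
    obtain ⟨a, ha⟩ := hx
    refine ⟨n * a, ?_⟩
    rw [← Int.cast_smul_eq_zsmul ℝ, real_inner_smul_left, ha]
    push_cast
    rfl

lemma root_reflectionPerm_self (P : RootPairing ι ℝ V V) (i : ι) :
    P.root (P.reflectionPerm i i) = -P.root i := by
  rw [P.root_reflectionPerm, P.reflection_apply_self]

lemma coroot_eq_neg_of_root_eq_neg [IsEuclidean P] {i j : ι} (h : P.root i = -P.root j) :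
    P.coroot i = -P.coroot j := by
  rw [IsEuclidean.coroot_eq, IsEuclidean.coroot_eq, h, inner_neg_neg, smul_neg]

lemma weylGroup_ext [P.IsRootSystem] {w w' : P.weylGroup} (h : ∀ x : V, w • x = w' • x) :
    w = w' := by
  apply Subtype.ext
  apply RootPairing.Equiv.weightHom_injective P
  exact LinearEquiv.ext h

lemma inner_smul_left_eq [IsEuclidean P] (w : P.weylGroup) (x y : V) :
    inner ℝ (w • x) y = inner ℝ x (w⁻¹ • y) := by
  rw [← inner_smul_smul w x (w⁻¹ • y), smul_inv_smul]

lemma smul_mem_weightLattice [IsEuclidean P] (w : P.weylGroup) {x : V}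
    (hx : x ∈ weightLattice P) : w • x ∈ weightLattice P := by
  intro q hq
  rw [inner_smul_left_eq]
  exact hx _ (smul_mem_corootSpan _ hq)

/-! ### The cone of nonnegative combinations of simple roots -/

/-- The combinations of simple roots with nonnegative integer coefficients. -/
abbrev posCone (b : P.Base) : AddSubmonoid V :=
  AddSubmonoid.closure (P.root '' (b.support : Set ι))

variable {b : P.Base}

lemma inner_posCone_nonneg {x c : V} (hx : ∀ i ∈ b.support, 0 ≤ inner ℝ x (P.root i))
    (hc : c ∈ posCone b) : 0 ≤ inner ℝ x c := by
  induction hc using AddSubmonoid.closure_induction with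
  | mem y hy => obtain ⟨i, hi, rfl⟩ := hy; exact hx i hi
  | zero => simp
  | add y z _ _ hy hz => rw [inner_add_right]; exact add_nonneg hy hz

/-- A sum of nonnegative terms vanishes only termwise, and only `i₀` can contribute a zero term.
Used for points in the relative interior of the wall of `i₀`. -/
lemma eq_nsmul_of_inner_eq_zero {x c : V} {i₀ : ι}
    (hx : ∀ i ∈ b.support, i ≠ i₀ → 0 < inner ℝ x (P.root i)) (hx₀ : 0 ≤ inner ℝ x (P.root i₀))
    (hc : c ∈ posCone b) (h : inner ℝ x c = 0) : ∃ t : ℕ, c = t • P.root i₀ := by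
  have hx' : ∀ i ∈ b.support, 0 ≤ inner ℝ x (P.root i) := fun i hi => by
    by_cases h : i = i₀
    · rwa [h]
    · exact (hx i hi h).le
  induction hc using AddSubmonoid.closure_induction with
  | mem y hy =>
    obtain ⟨i, hi, rfl⟩ := hy
    by_cases hi₀ : i = i₀
    · exact ⟨1, by simp [hi₀]⟩
    · exact absurd h (hx i hi hi₀).ne'
  | zero => exact ⟨0, by simp⟩
  | add y z hy hz ihy ihz =>
    have h₁ := inner_posCone_nonneg hx' hy
    have h₂ := inner_posCone_nonneg hx' hz
    rw [inner_add_right] at h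
    obtain ⟨s, hs⟩ := ihy (by linarith)
    obtain ⟨t, ht⟩ := ihz (by linarith)
    exact ⟨s + t, by rw [add_smul, hs, ht]⟩

lemma eq_zero_of_inner_eq_zero {x c : V} (hx : ∀ i ∈ b.support, 0 < inner ℝ x (P.root i))
    (hc : c ∈ posCone b) (h : inner ℝ x c = 0) : c = 0 := by
  induction hc using AddSubmonoid.closure_induction with
  | mem y hy => obtain ⟨i, hi, rfl⟩ := hy; exact absurd h (hx i hi).ne'
  | zero => rfl
  | add y z hy hz ihy ihz =>
    have h₁ := inner_posCone_nonneg (fun i hi => (hx i hi).le) hy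
    have h₂ := inner_posCone_nonneg (fun i hi => (hx i hi).le) hz
    rw [inner_add_right] at h
    rw [ihy (by linarith), ihz (by linarith), add_zero]

lemma inner_posCone_pos {x c : V} (hx : ∀ i ∈ b.support, 0 < inner ℝ x (P.root i))
    (hc : c ∈ posCone b) (h : c ≠ 0) : 0 < inner ℝ x c :=
  (inner_posCone_nonneg (fun i hi => (hx i hi).le) hc).lt_of_ne'
    fun h' => h (eq_zero_of_inner_eq_zero hx hc h')

lemma exists_inner_root_eq [FiniteDimensional ℝ V] [P.IsRootSystem] (b : P.Base) (y : ι → ℝ) :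
    ∃ x : V, ∀ i ∈ b.support, inner ℝ x (P.root i) = y i := by
  obtain ⟨x, hx⟩ := exists_inner_basis_eq b.toWeightBasis fun i => y i
  exact ⟨x, fun i hi => by simpa using hx ⟨i, hi⟩⟩

/-- Pair with a vector on which every simple root takes the value 1: the height of `c` is then both
nonnegative and nonpositive. -/
lemma eq_zero_of_mem_posCone_of_neg_mem [FiniteDimensional ℝ V] [P.IsRootSystem] {c : V}
    (hc : c ∈ posCone b) (hc' : -c ∈ posCone b) : c = 0 := by
  obtain ⟨x, hx⟩ := exists_inner_root_eq b fun _ => 1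
  have hx' : ∀ i ∈ b.support, 0 ≤ inner ℝ x (P.root i) := fun i hi => by simp [hx i hi]
  have h₁ := inner_posCone_nonneg hx' hc
  have h₂ := inner_posCone_nonneg hx' hc'
  rw [inner_neg_right] at h₂
  exact eq_zero_of_inner_eq_zero (x := x) (fun i hi => by simp [hx i hi]) hc (by linarith)

/-! ### The highest root -/

section Highest

variable {ξ : ι}

lemma IsHighestRoot.mem_posCone [FiniteDimensional ℝ V] [P.IsRootSystem]
    (hξ : IsHighestRoot b ξ) : P.root ξ ∈ posCone b := by
  refine (b.root_mem_or_neg_mem ξ).resolve_right fun h => ?_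
  -- Maximality applied to the root −ξ puts 2ξ in the cone; adding −ξ puts ξ there along with −ξ.
  have h₁ := hξ (P.reflectionPerm ξ ξ)
  rw [root_reflectionPerm_self, sub_neg_eq_add] at h₁
  have h₂ : P.root ξ + P.root ξ + -P.root ξ ∈ posCone b := add_mem h₁ h
  rw [add_neg_cancel_right] at h₂
  exact P.ne_zero ξ (eq_zero_of_mem_posCone_of_neg_mem h₂ h)

lemma IsHighestRoot.inner_root_le [FiniteDimensional ℝ V] [P.IsRootSystem]
    (hξ : IsHighestRoot b ξ) {x : V} (hx : ∀ i ∈ b.support, 0 ≤ inner ℝ x (P.root i)) (i : ι) :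
    inner ℝ x (P.root i) ≤ inner ℝ x (P.root ξ) := by
  have := inner_posCone_nonneg hx (hξ i)
  rw [inner_sub_right] at this
  linarith

/-- If the pairing were n + 2, maximality of ξ against −r_ξ α = (n+2)ξ − α would put α − (n+1)ξ in
the cone, hence α − ξ as well, while ξ − α is there already. -/
lemma IsHighestRoot.pairingIn_le_one [FiniteDimensional ℝ V] [P.IsRootSystem]
    [P.IsCrystallographic] (hξ : IsHighestRoot b ξ) {i : ι} (hi : P.root i ≠ P.root ξ) :
    P.pairingIn ℤ i ξ ≤ 1 := by
  by_contra! h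
  obtain ⟨n, hn⟩ : ∃ n : ℕ, P.pairingIn ℤ i ξ = n + 2 :=
    ⟨(P.pairingIn ℤ i ξ - 2).toNat, by omega⟩
  have h₂ := hξ (P.reflectionPerm (P.reflectionPerm ξ i) (P.reflectionPerm ξ i))
  rw [root_reflectionPerm_self, P.root_reflectionPerm, P.reflection_apply_root' ℤ, hn] at h₂
  have h₃ : P.root i - P.root ξ ∈ posCone b := by
    have h₄ := add_mem h₂ (nsmul_mem hξ.mem_posCone n)
    convert h₄ using 1
    module
  have h₅ := hξ i
  rw [← neg_sub] at h₅
  exact hi (sub_eq_zero.1 (eq_zero_of_mem_posCone_of_neg_mem h₃ h₅))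

lemma IsHighestRoot.pairingIn_eq [FiniteDimensional ℝ V] [P.IsRootSystem]
    [P.IsCrystallographic] (hξ : IsHighestRoot b ξ) {i : ι} (hi : P.root i ≠ P.root ξ)
    (hi' : P.root i ≠ -P.root ξ) (h₀ : P.pairingIn ℤ i ξ ≠ 0) :
    P.pairingIn ℤ i ξ = 1 ∨ P.pairingIn ℤ i ξ = -1 := by
  have h₁ := hξ.pairingIn_le_one hi
  have h₂ := hξ.pairingIn_le_one (i := P.reflectionPerm i i)
    (by rw [root_reflectionPerm_self]; exact fun h => hi' (by rw [← h, neg_neg]))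
  rw [P.pairingIn_reflectionPerm_self_left] at h₂
  omega

/-- The orbit of the highest coroot spans the coroot lattice. -/
lemma IsHighestRoot.corootSpan_le [FiniteDimensional ℝ V] [P.IsRootSystem] [IsEuclidean P]
    [P.IsCrystallographic] [P.IsIrreducible] (hξ : IsHighestRoot b ξ) (A : AddSubgroup V)
    (hA : ∀ w : P.weylGroup, w • P.coroot ξ ∈ A) {q : V} (hq : q ∈ P.corootSpan ℤ) : q ∈ A := by
  suffices h : P.corootSpan ℤ ≤ A.toIntSubmodule from h hq
  refine Submodule.span_le.2 ?_
  rintro _ ⟨i, rfl⟩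
  change P.coroot i ∈ A
  -- By irreducibility the Weyl orbit of any root spans V, so it cannot be orthogonal to ξ.
  obtain ⟨w, hw⟩ : ∃ w : P.weylGroup, inner ℝ (P.root ξ) (w • P.root i) ≠ 0 := by
    by_contra! h
    have h₁ : Submodule.span ℝ (MulAction.orbit P.weylGroup (P.root i)) ≤
        LinearMap.ker (innerₗ V (P.root ξ)) := by
      refine Submodule.span_le.2 ?_
      rintro _ ⟨w, rfl⟩
      exact h w
    rw [P.span_orbit_eq_top] at h₁
    exact (inner_root_self_pos P ξ).ne' (h₁ (Submodule.mem_top (x := P.root ξ)))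
  -- For β = w α_i different from ±ξ, the integer z = ⟨β, ξ^∨⟩ is ±1 and ξ^∨ − r_β ξ^∨ = z β^∨;
  -- multiplying by z recovers β^∨.
  have key : ∃ w' : P.weylGroup, ∃ z : ℤ, w • P.coroot i = z • (P.coroot ξ - w' • P.coroot ξ) ∨
      w • P.coroot i = z • P.coroot ξ := by
    rw [P.weylGroup_apply_root] at hw
    rw [smul_coroot]
    generalize P.weylGroupToPerm w i = j at hw ⊢
    by_cases h₁ : P.root j = P.root ξ
    · exact ⟨1, 1, Or.inr (by rw [P.root.injective h₁, one_smul])⟩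
    by_cases h₂ : P.root j = -P.root ξ
    · exact ⟨1, -1, Or.inr (by rw [coroot_eq_neg_of_root_eq_neg h₂, neg_one_zsmul])⟩
    have h₃ : (P.pairingIn ℤ j ξ : ℝ) = inner ℝ (P.root j) (P.coroot ξ) := by
      rw [inner_root_coroot, ← P.algebraMap_pairingIn ℤ]
      rfl
    have h₀ : P.pairingIn ℤ j ξ ≠ 0 := by
      intro h
      rw [h, inner_coroot, real_inner_comm (P.root ξ) (P.root j), Int.cast_zero] at h₃
      exact mul_ne_zero (div_ne_zero two_ne_zero (inner_root_self_pos P ξ).ne') hw h₃.symm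
    refine ⟨RootPairing.weylGroup.ofIdx P j, P.pairingIn ℤ j ξ, Or.inl ?_⟩
    rw [ofIdx_smul_eq', real_inner_comm, ← h₃, sub_sub_cancel, Int.cast_smul_eq_zsmul, smul_smul]
    rcases hξ.pairingIn_eq h₁ h₂ h₀ with h | h <;> simp [h]
  obtain ⟨w', z, h⟩ := key
  have h' : P.coroot i = z • (w⁻¹ • P.coroot ξ - (w⁻¹ * w') • P.coroot ξ) ∨
      P.coroot i = z • (w⁻¹ • P.coroot ξ) := by
    refine h.imp (fun h => ?_) (fun h => ?_)
    · rw [← inv_smul_smul w (P.coroot i), h, smul_comm, smul_sub, mul_smul]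
    · rw [← inv_smul_smul w (P.coroot i), h, smul_comm]
  rcases h' with h' | h' <;> rw [h']
  · exact A.zsmul_mem (A.sub_mem (hA _) (hA _)) z
  · exact A.zsmul_mem (hA _) z

lemma coroot_eq_root_of_norm [IsEuclidean P] (hnorm : inner ℝ (P.root ξ) (P.root ξ) = 2) :
    P.coroot ξ = P.root ξ := by
  rw [IsEuclidean.coroot_eq, hnorm]
  simp

lemma root_mem_weightLattice [IsEuclidean P] [P.IsCrystallographic] (i : ι) :
    P.root i ∈ weightLattice P := by
  intro q hq
  rw [real_inner_comm]
  exact exists_inner_root_eq_int i hq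

/-- The orbit of ξ^∨ = ξ spans the coroot lattice, and ξ lies in the W-stable lattice of weights.
This is where the normalization makes N Q^∨ a subgroup of the weights. -/
lemma IsHighestRoot.corootSpan_le_weightLattice [FiniteDimensional ℝ V] [P.IsRootSystem]
    [IsEuclidean P] [P.IsCrystallographic] [P.IsIrreducible] (hξ : IsHighestRoot b ξ)
    (hnorm : inner ℝ (P.root ξ) (P.root ξ) = 2) {q : V} (hq : q ∈ P.corootSpan ℤ) :
    q ∈ weightLattice P := by
  refine hξ.corootSpan_le (weightLattice P) (fun w => ?_) hq
  rw [coroot_eq_root_of_norm hnorm]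
  exact smul_mem_weightLattice w (root_mem_weightLattice ξ)

end Highest

end Basic

/-! ### Words in reflections -/

section Words

variable {G κ : Type*} [Group G] {s : κ → G} {D : G → κ → Prop}

lemma exists_list_prod_eq (hs : ∀ i, s i * s i = 1) (hgen : Subgroup.closure (Set.range s) = ⊤)
    (g : G) : ∃ l : List κ, (l.map s).prod = g := by
  have hg : g ∈ Subgroup.closure (Set.range s) := hgen ▸ Subgroup.mem_top g
  induction hg using Subgroup.closure_induction_left with
  | one => exact ⟨[], rfl⟩
  | mul_left x hx y _ ih =>
    obtain ⟨i, rfl⟩ := hx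
    obtain ⟨l, rfl⟩ := ih
    exact ⟨i :: l, by simp⟩
  | inv_mul_cancel x hx y _ ih =>
    obtain ⟨i, rfl⟩ := hx
    obtain ⟨l, rfl⟩ := ih
    exact ⟨i :: l, by simp [inv_eq_of_mul_eq_one_left (hs i)]⟩

/-- The exchange property. Here `D g i` stands for the positivity of the image of the `i`-th simple
root under `g⁻¹`. -/
lemma exists_prod_eq_mul_prod (h₁ : ∀ i, D 1 i)
    (h₂ : ∀ g i j, D g i → ¬ D (g * s j) i → s i * g = g * s j) (i : κ) (l : List κ)
    (hl : ¬ D (l.map s).prod i) :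
    ∃ l' : List κ, l'.length + 1 = l.length ∧ (l.map s).prod = s i * (l'.map s).prod := by
  induction l using List.reverseRecOn with
  | nil => exact absurd (h₁ i) hl
  | append_singleton t j ih =>
    have hp : ((t ++ [j]).map s).prod = (t.map s).prod * s j := by simp
    -- Positivity is lost either at the last letter, which is then deleted by `h₂`, or already in a
    -- shorter prefix.
    by_cases h : D (t.map s).prod i
    · rw [hp] at hl ⊢
      exact ⟨t, by simp, (h₂ _ i j h hl).symm⟩
    · obtain ⟨t', ht', h'⟩ := ih h
      exact ⟨t' ++ [j], by simp [ht'], by rw [hp, h']; simp [mul_assoc]⟩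

/-- Any nontrivial word either can be shortened, or starts with a reflection in a root which the
inverse of the word makes negative. -/
lemma exists_shorter_or (hs : ∀ i, s i * s i = 1) (h₁ : ∀ i, D 1 i)
    (h₂ : ∀ g i j, D g i → ¬ D (g * s j) i → s i * g = g * s j)
    (h₃ : ∀ g i, D (s i * g) i → ¬ D g i) (i : κ) (t : List κ)
    (h : D ((i :: t).map s).prod i) :
    ∃ l : List κ, l.length < (i :: t).length ∧ (l.map s).prod = ((i :: t).map s).prod := by
  rw [List.map_cons, List.prod_cons] at h ⊢
  obtain ⟨l, hl, h'⟩ := exists_prod_eq_mul_prod h₁ h₂ i t (h₃ _ i h)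
  refine ⟨l, by simp; omega, ?_⟩
  rw [h', ← mul_assoc, hs, one_mul]

/-- Positivity at the first letter of a word always allows shortening, so a shortest word for `g` is
empty. -/
lemma eq_one_of_forall_pos (hs : ∀ i, s i * s i = 1)
    (hgen : Subgroup.closure (Set.range s) = ⊤) (h₁ : ∀ i, D 1 i)
    (h₂ : ∀ g i j, D g i → ¬ D (g * s j) i → s i * g = g * s j)
    (h₃ : ∀ g i, D (s i * g) i → ¬ D g i) (g : G) (hg : ∀ i, D g i) : g = 1 := by
  obtain ⟨l, hl⟩ := exists_list_prod_eq hs hgen g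
  induction hn : l.length using Nat.strong_induction_on generalizing l with
  | _ n ih =>
    rcases l with _ | ⟨i, t⟩
    · exact hl.symm
    · obtain ⟨l', hl', h'⟩ := exists_shorter_or hs h₁ h₂ h₃ i t (hl ▸ hg i)
      exact ih _ (hn ▸ hl') l' (h'.trans hl) rfl

/-- If `g • a` is fixed by each simple reflection whose root `g⁻¹` makes negative,
for all `g` with `g • a ∈ F`, then the orbits meet `F` in at most one point. -/
lemma smul_eq_of_mem {X : Type*} [MulAction G X] {F : Set X} (hs : ∀ i, s i * s i = 1)
    (hgen : Subgroup.closure (Set.range s) = ⊤) (h₁ : ∀ i, D 1 i)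
    (h₂ : ∀ g i j, D g i → ¬ D (g * s j) i → s i * g = g * s j)
    (h₃ : ∀ g i, D (s i * g) i → ¬ D g i) {a : X}
    (h₄ : ∀ g i, ¬ D g i → g • a ∈ F → s i • g • a = g • a) (g : G) (hg : g • a ∈ F) :
    g • a = a := by
  obtain ⟨l, hl⟩ := exists_list_prod_eq hs hgen g
  induction hn : l.length using Nat.strong_induction_on generalizing l g with
  | _ n ih =>
    rcases l with _ | ⟨i, t⟩
    · rw [← hl]
      simp
    · by_cases hD : D g i
      · obtain ⟨l', hl', h'⟩ := exists_shorter_or hs h₁ h₂ h₃ i t (hl ▸ hD)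
        exact ih _ (hn ▸ hl') g hg l' (h'.trans hl) rfl
      -- Since `s i` fixes `g • a`, the element `g` may be replaced by `s i * g`, which is the tail
      -- of the word.
      · have h := h₄ g i hD hg
        have ht : (t.map s).prod = s i * g := by
          rw [← hl, List.map_cons, List.prod_cons, ← mul_assoc, hs, one_mul]
        rw [← mul_smul] at h
        rw [← h]
        exact ih t.length (by simp [← hn]) (s i * g) (h ▸ hg) t ht rfl

end Words

/-! ### The affine Weyl group -/

section Affine

variable {ι V : Type*} [NormedAddCommGroup V] [InnerProductSpace ℝ V]
variable {P : RootPairing ι ℝ V V} {b : P.Base} {ξ : ι}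

/-- The affine function `x ↦ ⟨x, α⟩ + n`. -/
def affineRoot (P : RootPairing ι ℝ V V) (β : ι × ℤ) (x : V) : ℝ :=
  inner ℝ x (P.root β.1) + β.2

/-- The simple affine roots `α₁, …, αₙ` and `1 - ξ`. -/
def simpleAffine (b : P.Base) (ξ : ι) : Option b.support → ι × ℤ
  | none => (P.reflectionPerm ξ ξ, 1)
  | some i => (i, 0)

lemma affineRoot_none (x : V) :
    affineRoot P (simpleAffine b ξ none) x = 1 - inner ℝ x (P.root ξ) := by
  simp [affineRoot, simpleAffine]
  ring

lemma affineRoot_some (i : b.support) (x : V) :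
    affineRoot P (simpleAffine b ξ (some i)) x = inner ℝ x (P.root i) := by
  simp [affineRoot, simpleAffine]

lemma mem_fundamentalDomain_iff {x : V} :
    x ∈ fundamentalDomain b ξ ↔ ∀ i, 0 ≤ affineRoot P (simpleAffine b ξ i) x := by
  simp only [Option.forall, affineRoot_none, affineRoot_some, fundamentalDomain]
  simp [and_comm]

variable [IsEuclidean P]

lemma affine_smul_eq (g : AffineWeylGroup P) (x : V) :
    g • x = g.right • x + (g.left.toAdd : V) :=
  rfl

lemma affine_ext [P.IsRootSystem] {g h : AffineWeylGroup P} (H : ∀ x : V, g • x = h • x) :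
    g = h := by
  have h₀ : (g.left.toAdd : V) = (h.left.toAdd : V) := by simpa [affine_smul_eq] using H 0
  refine SemidirectProduct.ext (Multiplicative.toAdd.injective (Subtype.ext h₀)) ?_
  refine weylGroup_ext fun x => ?_
  have := H x
  rwa [affine_smul_eq, affine_smul_eq, h₀, add_left_inj] at this

/-- One formula for all n + 1 generators, as reflections in the zero sets of the simple affine
roots; afterwards `none` needs no separate treatment. -/
lemma generator_smul (i : Option b.support) (x : V) :
    generator b ξ i • x =
      x - affineRoot P (simpleAffine b ξ i) x • P.coroot (simpleAffine b ξ i).1 := by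
  rcases i with _ | i
  · rw [affineRoot_none]
    change RootPairing.weylGroup.ofIdx P ξ • x + P.coroot ξ =
      x - (1 - inner ℝ x (P.root ξ)) • P.coroot (P.reflectionPerm ξ ξ)
    rw [ofIdx_smul_eq', coroot_eq_neg_of_root_eq_neg (root_reflectionPerm_self P ξ)]
    module
  · rw [affineRoot_some]
    change RootPairing.weylGroup.ofIdx P (i : ι) • x + 0 = x - inner ℝ x (P.root i) • P.coroot i
    rw [ofIdx_smul_eq', add_zero]

lemma inner_coroot_root (i : ι) : inner ℝ (P.coroot i) (P.root i) = 2 := by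
  rw [real_inner_comm, inner_coroot, div_mul_cancel₀ _ (inner_root_self_pos P i).ne']

lemma affineRoot_sub_smul_coroot (β : ι × ℤ) (x : V) (t : ℝ) :
    affineRoot P β (x - t • P.coroot β.1) = affineRoot P β x - 2 * t := by
  rw [affineRoot, affineRoot, inner_sub_left, real_inner_smul_left, inner_coroot_root]
  ring

lemma affineRoot_generator_smul (i : Option b.support) (x : V) :
    affineRoot P (simpleAffine b ξ i) (generator b ξ i • x) =
      -affineRoot P (simpleAffine b ξ i) x := by
  rw [generator_smul, affineRoot_sub_smul_coroot]
  ring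

lemma generator_mul_self [P.IsRootSystem] (i : Option b.support) :
    generator b ξ i * generator b ξ i = 1 := by
  refine affine_ext fun x => ?_
  rw [mul_smul, one_smul, generator_smul i (generator b ξ i • x), affineRoot_generator_smul,
    generator_smul]
  module

/-- The affine Weyl group permutes the affine roots. -/
lemma exists_affineRoot_smul [P.IsCrystallographic] (g : AffineWeylGroup P) (β : ι × ℤ) :
    ∃ β' : ι × ℤ, (∀ x, affineRoot P β' (g • x) = affineRoot P β x) ∧
      P.coroot β'.1 = g.right • P.coroot β.1 := by
  obtain ⟨z, hz⟩ := exists_inner_root_eq_int (P.weylGroupToPerm g.right β.1) g.left.toAdd.2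
  refine ⟨(P.weylGroupToPerm g.right β.1, β.2 - z), fun x => ?_, (smul_coroot _ _).symm⟩
  rw [affineRoot, affineRoot, affine_smul_eq, inner_add_left, hz, ← P.weylGroup_apply_root,
    inner_smul_smul]
  push_cast
  ring

/-! ### Generation by the simple affine reflections -/

/-- The simple reflections generate W. The product r_0 r_ξ is the translation by ξ^∨, its conjugates
under W are the translations by wξ^∨, and these generate T(Q^∨). -/
lemma closure_generator_eq_top [Finite ι] [FiniteDimensional ℝ V] [P.IsRootSystem]
    [P.IsCrystallographic] [P.IsReduced] [P.IsIrreducible] (hξ : IsHighestRoot b ξ) :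
    Subgroup.closure (Set.range (generator b ξ)) = ⊤ := by
  set H := Subgroup.closure (Set.range (generator b ξ)) with hH
  have hgen : ∀ i, generator b ξ i ∈ H := fun i => Subgroup.subset_closure ⟨i, rfl⟩
  have hrefl : ∀ i, (⟨1, RootPairing.weylGroup.ofIdx P i⟩ : AffineWeylGroup P) ∈ H := by
    intro i
    refine b.induction_reflect i
      (p := fun i => (⟨1, RootPairing.weylGroup.ofIdx P i⟩ : AffineWeylGroup P) ∈ H)
      (fun i hi => ?_) (fun i hi => hgen (some ⟨i, hi⟩)) ?_
    · convert hi using 1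
      refine affine_ext fun x => ?_
      simp only [affine_smul_eq, ofIdx_smul_eq, root_reflectionPerm_self,
        coroot_eq_neg_of_root_eq_neg (root_reflectionPerm_self P i), inner_neg_right, smul_neg,
        neg_smul, neg_neg]
    · intro i j hi hj
      have := H.mul_mem (H.mul_mem (hgen (some ⟨j, hj⟩)) hi) (hgen (some ⟨j, hj⟩))
      convert this using 1
      refine affine_ext fun x => ?_
      simp only [mul_smul]
      change P.reflection _ x + 0 =
        P.reflection j (P.reflection i (P.reflection j x + 0) + 0) + 0
      simp only [add_zero, P.reflection_reflectionPerm]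
      rfl
  have hW : ∀ w : P.weylGroup, (⟨1, w⟩ : AffineWeylGroup P) ∈ H := by
    rintro ⟨w, hw⟩
    induction hw using RootPairing.weylGroup.induction with
    | mem i => exact hrefl i
    | one => exact H.one_mem
    | mul g₁ g₂ hg₁ hg₂ h₁ h₂ =>
      convert H.mul_mem h₁ h₂ using 1
      refine affine_ext fun x => ?_
      simp only [mul_smul, affine_smul_eq, toAdd_one, ZeroMemClass.coe_zero, add_zero]
      rw [← mul_smul]
      rfl
  have hξH :
      (⟨.ofAdd ⟨P.coroot ξ, Submodule.subset_span ⟨ξ, rfl⟩⟩, 1⟩ : AffineWeylGroup P) ∈ H := by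
    convert H.mul_mem (hgen none) (hrefl ξ) using 1
    refine affine_ext fun x => ?_
    simp only [mul_smul, affine_smul_eq, toAdd_one, ZeroMemClass.coe_zero, add_zero, generator,
      one_smul, toAdd_ofAdd, ofIdx_smul_eq', inner_sub_left, real_inner_smul_left,
      inner_coroot_root]
    module
  let A : AddSubgroup V :=
    { carrier := {q | ∃ g ∈ H, ∀ x : V, g • x = x + q}
      zero_mem' := ⟨1, H.one_mem, by simp⟩
      add_mem' := by
        rintro q r ⟨g, hg, hgq⟩ ⟨h, hh, hhr⟩
        exact ⟨g * h, H.mul_mem hg hh, fun x => by rw [mul_smul, hhr, hgq]; abel⟩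
      neg_mem' := by
        rintro q ⟨g, hg, hgq⟩
        exact ⟨g⁻¹, H.inv_mem hg, fun x => by rw [inv_smul_eq_iff, hgq]; abel⟩ }
  have hA : ∀ q ∈ P.corootSpan ℤ, q ∈ A := by
    refine fun q hq => hξ.corootSpan_le A (fun w => ?_) hq
    refine ⟨_, H.mul_mem (H.mul_mem (hW w) hξH) (H.inv_mem (hW w)), fun x => ?_⟩
    have hw : (⟨1, w⟩ : AffineWeylGroup P)⁻¹ • x = w⁻¹ • x := by
      rw [inv_smul_eq_iff]
      simp [affine_smul_eq]
    rw [mul_smul, hw, mul_smul]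
    simp [affine_smul_eq]
  rw [eq_top_iff]
  intro g _
  obtain ⟨h, hh, hq⟩ := hA _ g.left.toAdd.2
  convert H.mul_mem hh (hW g.right) using 1
  refine affine_ext fun x => ?_
  rw [mul_smul, hq]
  simp [affine_smul_eq]

end Affine

/-! ### The fundamental domain -/

section FundamentalDomain

variable {ι V : Type*} [NormedAddCommGroup V] [InnerProductSpace ℝ V]
variable {P : RootPairing ι ℝ V V} {b : P.Base} {ξ : ι}

/-- The points of the fundamental domain which are on no wall. -/
def alcove (b : P.Base) (ξ : ι) : Set V :=
  {x | ∀ i, 0 < affineRoot P (simpleAffine b ξ i) x}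

lemma mem_alcove_iff {x : V} : x ∈ alcove b ξ ↔
    (∀ i ∈ b.support, 0 < inner ℝ x (P.root i)) ∧ inner ℝ x (P.root ξ) < 1 := by
  simp only [alcove, Set.mem_ofPred_eq, Option.forall, affineRoot_none, affineRoot_some]
  simp [and_comm]

lemma alcove_subset {x : V} (hx : x ∈ alcove b ξ) : x ∈ fundamentalDomain b ξ :=
  mem_fundamentalDomain_iff.2 fun i => (hx i).le

lemma eq_of_root_eq_nsmul [P.IsReduced] {i j : ι} {t : ℕ} (h : P.root i = t • P.root j) :
    i = j := by
  have h₁ : ¬ LinearIndependent ℝ ![P.root i, P.root j] := by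
    intro hli
    have := (LinearIndependent.pair_iff.1 hli) 1 (-t)
      (by rw [h, ← Nat.cast_smul_eq_nsmul ℝ]; module)
    exact one_ne_zero this.1
  rcases RootPairing.IsReduced.eq_or_eq_neg i j h₁ with h₂ | h₂
  · exact P.root.injective h₂
  · have h₃ : ((t : ℝ) + 1) • P.root j = 0 := by
      rw [add_smul, one_smul, Nat.cast_smul_eq_nsmul, ← h, h₂, neg_add_cancel]
    rcases smul_eq_zero.1 h₃ with h₄ | h₄
    · have : (0 : ℝ) ≤ t := t.cast_nonneg
      linarith
    · exact absurd h₄ (P.ne_zero j)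

lemma not_pos_of_pos_generator_mul [IsEuclidean P] {x₀ : V} (g : AffineWeylGroup P)
    (i : Option b.support)
    (h : 0 < affineRoot P (simpleAffine b ξ i) ((generator b ξ i * g) • x₀)) :
    ¬ 0 < affineRoot P (simpleAffine b ξ i) (g • x₀) := by
  rw [mul_smul, affineRoot_generator_smul] at h
  linarith

lemma corootSpan_eq_span_basis [P.IsRootSystem] (b : P.Base) :
    P.corootSpan ℤ = Submodule.span ℤ (Set.range b.toCoweightBasis) := by
  refine b.span_int_coroot_support.symm.trans ?_
  congr 1
  ext x
  simp

variable [FiniteDimensional ℝ V] [P.IsRootSystem]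

lemma exists_mem_alcove (hξ : IsHighestRoot b ξ) : ∃ x, x ∈ alcove b ξ := by
  obtain ⟨x, hx⟩ := exists_inner_root_eq b fun _ => 1
  have hc : 0 ≤ inner ℝ x (P.root ξ) :=
    inner_posCone_nonneg (fun i hi => by simp [hx i hi]) hξ.mem_posCone
  refine ⟨(inner ℝ x (P.root ξ) + 1)⁻¹ • x, mem_alcove_iff.2 ⟨fun i hi => ?_, ?_⟩⟩
  · rw [real_inner_smul_left, hx i hi]
    positivity
  · rw [real_inner_smul_left, inv_mul_lt_iff₀ (by positivity)]
    linarith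

/-- At a point of the open alcove every root takes a value strictly between −1 and 1 and different
from 0, so never an integer. -/
lemma affineRoot_ne_zero (hξ : IsHighestRoot b ξ) {x : V} (hx : x ∈ alcove b ξ) (β : ι × ℤ) :
    affineRoot P β x ≠ 0 := by
  obtain ⟨h₁, h₂⟩ := mem_alcove_iff.1 hx
  have h₃ := hξ.inner_root_le fun i hi => (h₁ i hi).le
  have h₄ := h₃ β.1
  have h₅ := h₃ (P.reflectionPerm β.1 β.1)
  rw [root_reflectionPerm_self, inner_neg_right] at h₅
  have h₆ : inner ℝ x (P.root β.1) ≠ 0 := by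
    rcases b.root_mem_or_neg_mem β.1 with h | h
    · exact (inner_posCone_pos h₁ h (P.ne_zero _)).ne'
    · have := inner_posCone_pos h₁ h (neg_ne_zero.2 (P.ne_zero _))
      rw [inner_neg_right] at this
      linarith
  intro h
  rw [affineRoot] at h
  have h₇ : (-1 : ℝ) < β.2 := by linarith
  have h₈ : (β.2 : ℝ) < 1 := by linarith
  have h₉ : β.2 = 0 := by
    have : (-1 : ℤ) < β.2 := by exact_mod_cast h₇
    have : β.2 < (1 : ℤ) := by exact_mod_cast h₈
    omega
  rw [h₉, Int.cast_zero, add_zero] at h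
  exact h₆ h

/-- No affine root hyperplane separates points of F. Positivity at `x₀` forces the integer part to
be at least 0 for a positive root and at least 1 for a negative one; the bounds 0 ≤ ⟨x,α⟩ and −1 ≤
⟨x,α⟩ on F then suffice. -/
lemma affineRoot_nonneg (hξ : IsHighestRoot b ξ) {x₀ x : V} (hx₀ : x₀ ∈ alcove b ξ)
    (hx : x ∈ fundamentalDomain b ξ) {β : ι × ℤ} (h : 0 < affineRoot P β x₀) :
    0 ≤ affineRoot P β x := by
  obtain ⟨h₁, h₂⟩ := mem_alcove_iff.1 hx₀
  rw [affineRoot] at h ⊢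
  rcases b.root_mem_or_neg_mem β.1 with hβ | hβ
  · have h₃ := inner_posCone_nonneg hx.1 hβ
    have h₄ := hξ.inner_root_le (fun i hi => (h₁ i hi).le) β.1
    have h₅ : (-1 : ℝ) < β.2 := by linarith
    have h₆ : (-1 : ℤ) < β.2 := by exact_mod_cast h₅
    have h₇ : (0 : ℝ) ≤ β.2 := by exact_mod_cast (by omega : (0 : ℤ) ≤ β.2)
    linarith
  · have h₃ := inner_posCone_nonneg (fun i hi => (h₁ i hi).le) hβ
    have h₄ := hξ.inner_root_le hx.1 (P.reflectionPerm β.1 β.1)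
    rw [root_reflectionPerm_self, inner_neg_right] at h₄
    rw [inner_neg_right] at h₃
    have h₅ : (0 : ℝ) < β.2 := by linarith
    have h₆ : (0 : ℤ) < β.2 := by exact_mod_cast h₅
    have h₇ : (1 : ℝ) ≤ β.2 := by exact_mod_cast (by omega : (1 : ℤ) ≤ β.2)
    have := hx.2
    linarith

/-- Each wall of the fundamental domain has a point which is on no other hyperplane of an affine
root. -/
lemma exists_wall_point [P.IsReduced] (hξ : IsHighestRoot b ξ) {x₀ : V} (hx₀ : x₀ ∈ alcove b ξ)
    (j : Option b.support) :
    ∃ p ∈ fundamentalDomain b ξ, affineRoot P (simpleAffine b ξ j) p = 0 ∧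
      ∀ β, 0 < affineRoot P β x₀ → affineRoot P β p = 0 → β = simpleAffine b ξ j := by
  classical
  obtain ⟨hx₁, hx₂⟩ := mem_alcove_iff.1 hx₀
  rcases j with _ | ⟨i, hi⟩
  -- For the affine wall: all simple roots positive, scaled so that ξ takes the value 1. Then ξ is
  -- the only root with value 1.
  · obtain ⟨x, hx⟩ := exists_inner_root_eq b fun _ => 1
    have hc : 0 < inner ℝ x (P.root ξ) :=
      inner_posCone_pos (fun i hi => by simp [hx i hi]) hξ.mem_posCone (P.ne_zero ξ)
    set p := (inner ℝ x (P.root ξ))⁻¹ • x with hp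
    have h₁ : ∀ i ∈ b.support, 0 < inner ℝ p (P.root i) := fun i hi => by
      rw [hp, real_inner_smul_left, hx i hi]
      positivity
    have h₂ : inner ℝ p (P.root ξ) = 1 := by
      rw [hp, real_inner_smul_left, inv_mul_cancel₀ hc.ne']
    have h₃ := hξ.inner_root_le fun i hi => (h₁ i hi).le
    have h₄ : ∀ i, inner ℝ p (P.root i) = 1 → i = ξ := fun i hi => by
      have := eq_zero_of_inner_eq_zero h₁ (hξ i) (by rw [inner_sub_right, hi, h₂, sub_self])
      exact (P.root.injective (sub_eq_zero.1 this)).symm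
    refine ⟨p, ⟨fun i hi => (h₁ i hi).le, h₂.le⟩, by rw [affineRoot_none, h₂, sub_self], ?_⟩
    rintro ⟨a, n⟩ h₅ h₆
    simp only [affineRoot] at h₅ h₆
    rcases b.root_mem_or_neg_mem a with ha | ha
    -- A positive root through `p` would have to give the affine function ξ − 1, which is negative
    -- at `x₀`.
    · exfalso
      have h₇ := inner_posCone_pos h₁ ha (P.ne_zero a)
      have h₈ := h₃ a
      rw [h₂] at h₈
      have h₉ : n = -1 := by
        have h₁₀ : (n : ℝ) < 0 := by linarith
        have h₁₁ : (-1 : ℝ) ≤ n := by linarith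
        have h₁₂ : n < 0 := by exact_mod_cast h₁₀
        have h₁₃ : -1 ≤ n := by exact_mod_cast h₁₁
        omega
      rw [h₉] at h₅ h₆
      push_cast at h₅ h₆
      rw [h₄ a (by linarith)] at h₅
      linarith
    · have h₇ := inner_posCone_pos h₁ ha (neg_ne_zero.2 (P.ne_zero a))
      have h₈ := h₃ (P.reflectionPerm a a)
      rw [root_reflectionPerm_self, inner_neg_right, h₂] at h₈
      rw [inner_neg_right] at h₇
      have h₉ : n = 1 := by
        have h₁₀ : (0 : ℝ) < n := by linarith
        have h₁₁ : (n : ℝ) ≤ 1 := by linarith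
        have h₁₂ : 0 < n := by exact_mod_cast h₁₀
        have h₁₃ : n ≤ 1 := by exact_mod_cast h₁₁
        omega
      rw [h₉] at h₆
      push_cast at h₆
      have h₁₀ := h₄ (P.reflectionPerm a a)
        (by rw [root_reflectionPerm_self, inner_neg_right]; linarith)
      refine Prod.ext (P.root.injective ?_) h₉
      change P.root a = P.root (P.reflectionPerm ξ ξ)
      rw [root_reflectionPerm_self, ← h₁₀, root_reflectionPerm_self, neg_neg]
  -- For the wall of α_i: only α_i vanishes among the simple roots, and scaling brings ξ below 1,
  -- which rules out all nonzero integer parts.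
  · obtain ⟨x, hx⟩ := exists_inner_root_eq b fun k => if k = i then 0 else 1
    have hx' : ∀ k ∈ b.support, 0 ≤ inner ℝ x (P.root k) := fun k hk => by
      rw [hx k hk]
      split_ifs <;> simp
    have hc : 0 ≤ inner ℝ x (P.root ξ) := inner_posCone_nonneg hx' hξ.mem_posCone
    set p := (inner ℝ x (P.root ξ) + 1)⁻¹ • x with hp
    have h₁ : ∀ k ∈ b.support, k ≠ i → 0 < inner ℝ p (P.root k) := fun k hk hki => by
      rw [hp, real_inner_smul_left, hx k hk, if_neg hki]
      positivity
    have h₀ : inner ℝ p (P.root i) = 0 := by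
      rw [hp, real_inner_smul_left, hx i hi, if_pos rfl, mul_zero]
    have h₁' : ∀ k ∈ b.support, 0 ≤ inner ℝ p (P.root k) := fun k hk => by
      rw [hp, real_inner_smul_left]
      exact mul_nonneg (by positivity) (hx' k hk)
    have h₂ : inner ℝ p (P.root ξ) < 1 := by
      rw [hp, real_inner_smul_left, inv_mul_lt_iff₀ (by positivity)]
      linarith
    have h₃ := hξ.inner_root_le h₁'
    refine ⟨p, ⟨h₁', h₂.le⟩, by rw [affineRoot_some, h₀], ?_⟩
    rintro ⟨a, n⟩ h₅ h₆
    simp only [affineRoot] at h₅ h₆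
    have h₇ := h₃ a
    have h₈ := h₃ (P.reflectionPerm a a)
    rw [root_reflectionPerm_self, inner_neg_right] at h₈
    have h₉ : n = 0 := by
      have h₁₀ : (-1 : ℝ) < n := by linarith
      have h₁₁ : (n : ℝ) < 1 := by linarith
      have h₁₂ : -1 < n := by exact_mod_cast h₁₀
      have h₁₃ : n < 1 := by exact_mod_cast h₁₁
      omega
    rw [h₉, Int.cast_zero, add_zero] at h₅ h₆
    rcases b.root_mem_or_neg_mem a with ha | ha
    · obtain ⟨t, ht⟩ := eq_nsmul_of_inner_eq_zero h₁ h₀.ge ha h₆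
      exact Prod.ext (eq_of_root_eq_nsmul ht) h₉
    · have := inner_posCone_nonneg (fun i hi => (hx₁ i hi).le) ha
      rw [inner_neg_right] at this
      linarith

/-! ### Orbits of the affine Weyl group -/

variable [IsEuclidean P]

/-- Each orbit of the affine Weyl group meets the fundamental domain. -/
theorem exists_smul_mem_fundamentalDomain [Finite ι] (hξ : IsHighestRoot b ξ) (a : V) :
    ∃ g : AffineWeylGroup P, g • a ∈ fundamentalDomain b ξ := by
  obtain ⟨x₀, hx₀⟩ := exists_mem_alcove hξ
  -- Only finitely many group elements move `a` no farther from `x₀`: their translation parts are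
  -- lattice points in a fixed ball, and W is finite.
  set S : Set (AffineWeylGroup P) := {g | ‖g • a - x₀‖ ≤ ‖a - x₀‖} with hS
  have hfin : S.Finite := by
    have h₁ := ZSpan.setFinite_inter b.toCoweightBasis
      (Metric.isBounded_closedBall (x := (0 : V)) (r := ‖a - x₀‖ + ‖x₀‖ + ‖a‖))
    rw [← corootSpan_eq_span_basis] at h₁
    refine Set.Finite.of_finite_image (f := fun g => ((g.left.toAdd : V), g.right))
      ((h₁.prod Set.finite_univ).subset ?_) ?_
    · rintro _ ⟨g, hg, rfl⟩
      refine ⟨⟨?_, g.left.toAdd.2⟩, Set.mem_univ _⟩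
      rw [mem_closedBall_zero_iff]
      have h₂ : ‖g.right • a‖ = ‖a‖ := by
        rw [@norm_eq_sqrt_real_inner V _ _ (g.right • a), inner_smul_smul,
          ← norm_eq_sqrt_real_inner]
      have h₃ : (g.left.toAdd : V) = (g • a - x₀) + x₀ - g.right • a := by
        rw [affine_smul_eq]
        abel
      calc ‖(g.left.toAdd : V)‖ ≤ ‖g • a - x₀‖ + ‖x₀‖ + ‖g.right • a‖ := by
            rw [h₃]
            exact (norm_sub_le _ _).trans (add_le_add_left (norm_add_le _ _) _)
        _ ≤ _ := by rw [h₂]; gcongr; exact hg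
    · intro g _ h _ hgh
      simp only [Prod.mk.injEq] at hgh
      exact SemidirectProduct.ext (Multiplicative.toAdd.injective (Subtype.ext hgh.1)) hgh.2
  obtain ⟨g, hg, hmin⟩ := Set.exists_min_image S (fun g => ‖g • a - x₀‖) hfin ⟨1, by simp [hS]⟩
  refine ⟨g, mem_fundamentalDomain_iff.2 fun i => ?_⟩
  by_contra! hneg
  -- A reflection in a hyperplane β = 0 separating y from `x₀` brings y closer: the squared distance
  -- changes by 4 β(y) β(x₀)/⟨α,α⟩ < 0, with α the root of β.
  have hlt : ‖(generator b ξ i * g) • a - x₀‖ < ‖g • a - x₀‖ := by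
    have hpos := hx₀ i
    rw [mul_smul, generator_smul]
    generalize simpleAffine b ξ i = β at hneg hpos
    set y := g • a
    refine lt_of_pow_lt_pow_left₀ 2 (norm_nonneg _) ?_
    have h₁ : y - affineRoot P β y • P.coroot β.1 - x₀ =
        (y - x₀) - affineRoot P β y • P.coroot β.1 := by abel
    have hα := inner_root_self_pos P β.1
    have h₂ : inner ℝ (y - x₀) (P.coroot β.1) = 2 / inner ℝ (P.root β.1) (P.root β.1) *
        (affineRoot P β y - affineRoot P β x₀) := by
      rw [inner_coroot, inner_sub_left, affineRoot, affineRoot]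
      ring
    have h₃ : ‖P.coroot β.1‖ ^ 2 = 4 / inner ℝ (P.root β.1) (P.root β.1) := by
      rw [← real_inner_self_eq_norm_sq, inner_coroot, inner_coroot_root]
      ring
    rw [h₁, norm_sub_sq_real, real_inner_smul_right, h₂, norm_smul, mul_pow, h₃,
      Real.norm_eq_abs, sq_abs]
    have h₄ : 0 < -(affineRoot P β y) * affineRoot P β x₀ *
        (4 / inner ℝ (P.root β.1) (P.root β.1)) := by
      have : 0 < -affineRoot P β y := by linarith
      positivity
    have h₅ : ∀ c u v r : ℝ, r - 2 * (u * (2 / c * (u - v))) + u ^ 2 * (4 / c) =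
        r - -u * v * (4 / c) := fun c u v r => by ring
    rw [h₅]
    linarith
  exact hlt.not_ge (hmin _ (hlt.le.trans hg))

variable [P.IsCrystallographic] [P.IsReduced]

/-- The hypotheses of the exchange property hold in the affine Weyl group. -/
lemma generator_mul_eq_mul_generator (hξ : IsHighestRoot b ξ) {x₀ : V} (hx₀ : x₀ ∈ alcove b ξ)
    (g : AffineWeylGroup P) (i j : Option b.support)
    (h : 0 < affineRoot P (simpleAffine b ξ i) (g • x₀))
    (h' : ¬ 0 < affineRoot P (simpleAffine b ξ i) ((g * generator b ξ j) • x₀)) :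
    generator b ξ i * g = g * generator b ξ j := by
  obtain ⟨β, hβ, hβ'⟩ := exists_affineRoot_smul g⁻¹ (simpleAffine b ξ i)
  have hβg : ∀ x, affineRoot P (simpleAffine b ξ i) (g • x) = affineRoot P β x := fun x => by
    rw [← hβ (g • x), inv_smul_smul]
  obtain ⟨γ, hγ, -⟩ := exists_affineRoot_smul (generator b ξ j)⁻¹ β
  have hγg : ∀ x, affineRoot P β (generator b ξ j • x) = affineRoot P γ x := fun x => by
    rw [← hγ (generator b ξ j • x), inv_smul_smul]
  rw [hβg] at h
  rw [mul_smul, hβg, hγg] at h'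
  -- The functions β and γ = β ∘ r_j have opposite signs at `x₀`, hence weakly opposite signs at
  -- `p`; they agree there because r_j fixes `p`. So β vanishes at `p` and must be the simple affine
  -- root `j`.
  obtain ⟨p, hp, hp₀, huniq⟩ := exists_wall_point hξ hx₀ j
  have h₁ := affineRoot_nonneg hξ hx₀ hp h
  have hγ0 := affineRoot_ne_zero hξ hx₀ γ
  have h₂ : affineRoot P γ p ≤ 0 := by
    obtain ⟨γ', hγ'⟩ : ∃ γ' : ι × ℤ, ∀ x, affineRoot P γ' x = -affineRoot P γ x :=
      ⟨(P.reflectionPerm γ.1 γ.1, -γ.2), fun x => by simp [affineRoot]; ring⟩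
    have := affineRoot_nonneg hξ hx₀ hp (β := γ')
      (by rw [hγ']; exact neg_pos.2 ((not_lt.1 h').lt_of_ne hγ0))
    rw [hγ'] at this
    linarith
  have h₃ : affineRoot P γ p = affineRoot P β p := by
    rw [← hγg, generator_smul, hp₀, zero_smul, sub_zero]
  obtain rfl := huniq β h (by linarith)
  refine affine_ext fun x => ?_
  rw [mul_smul, mul_smul, generator_smul i, generator_smul j, hβg, hβ', affine_smul_eq,
    affine_smul_eq, smul_sub, smul_comm g.right, SemidirectProduct.inv_right, smul_inv_smul]
  abel

variable [Finite ι] [P.IsIrreducible]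

/-- Points on no wall of the fundamental domain are in different orbits, and have trivial
stabilizers. -/
theorem eq_one_of_smul_mem_alcove (hξ : IsHighestRoot b ξ) {x₀ : V} (hx₀ : x₀ ∈ alcove b ξ)
    {g : AffineWeylGroup P} (hg : g • x₀ ∈ alcove b ξ) : g = 1 :=
  eq_one_of_forall_pos (D := fun g i => 0 < affineRoot P (simpleAffine b ξ i) (g • x₀))
    generator_mul_self (closure_generator_eq_top hξ) (fun i => by rw [one_smul]; exact hx₀ i)
    (generator_mul_eq_mul_generator hξ hx₀) not_pos_of_pos_generator_mul g hg

/-- Each orbit of the affine Weyl group meets the fundamental domain in at most one point. -/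
theorem smul_eq_of_mem_fundamentalDomain (hξ : IsHighestRoot b ξ) {a : V}
    (ha : a ∈ fundamentalDomain b ξ) {g : AffineWeylGroup P}
    (hg : g • a ∈ fundamentalDomain b ξ) : g • a = a := by
  obtain ⟨x₀, hx₀⟩ := exists_mem_alcove hξ
  refine smul_eq_of_mem (D := fun g i => 0 < affineRoot P (simpleAffine b ξ i) (g • x₀))
    generator_mul_self (closure_generator_eq_top hξ) (fun i => by rw [one_smul]; exact hx₀ i)
    (generator_mul_eq_mul_generator hξ hx₀) not_pos_of_pos_generator_mul (fun h i hD hh => ?_) g hg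
  have h₁ := mem_fundamentalDomain_iff.1 hh i
  -- This β is minus the pullback under `h` of the simple affine root `i`. It is positive at `x₀`,
  -- so nonnegative at `a`; since also `h • a ∈ F`, the point `h • a` lies on wall `i`.
  obtain ⟨β, hβ, -⟩ := exists_affineRoot_smul (generator b ξ i * h)⁻¹ (simpleAffine b ξ i)
  have hβ' : ∀ x, affineRoot P β x = -affineRoot P (simpleAffine b ξ i) (h • x) := fun x => by
    rw [← affineRoot_generator_smul, ← mul_smul, ← hβ, inv_smul_smul]
  have h₂ := affineRoot_nonneg hξ hx₀ ha (β := β)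
    (lt_of_le_of_ne (by rw [hβ']; linarith) (affineRoot_ne_zero hξ hx₀ β).symm)
  rw [hβ'] at h₂
  rw [generator_smul, le_antisymm (by linarith) h₁, zero_smul, sub_zero]

end FundamentalDomain

/-! ### The index of the coroot lattice -/

/-- Coordinates of one lattice basis in the other are the same over ℤ and over ℝ, so the integer
determinant giving the index may be computed over ℝ. -/
lemma relIndex_eq_abs_det_real {E : Type*} [AddCommGroup E] [Module ℝ E]
    (L₁ L₂ : AddSubgroup E) (H : L₁ ≤ L₂) {κ : Type*} [DecidableEq κ] [Fintype κ]
    (b₁ b₂ : Module.Basis κ ℝ E) (h₁ : L₁ = .closure (Set.range b₁))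
    (h₂ : L₂ = .closure (Set.range b₂)) :
    (L₁.relIndex L₂ : ℝ) = |b₂.det b₁| := by
  rw [AddSubgroup.relIndex_eq_natAbs_det L₁ L₂ H (b₁.addSubgroupOfClosure L₁ h₁)
    (b₂.addSubgroupOfClosure L₂ h₂), Nat.cast_natAbs, Int.cast_abs]
  change |algebraMap ℤ ℝ _| = _
  rw [Module.Basis.det_apply, Module.Basis.det_apply, RingHom.map_det]
  congr
  ext
  simp only [RingHom.mapMatrix_apply, Matrix.map_apply, Module.Basis.toMatrix_apply,
    Module.Basis.addSubgroupOfClosure_apply]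
  exact Module.Basis.addSubgroupOfClosure_repr_apply _ _ h₂ _ _

section Index

variable {ι V : Type*} [NormedAddCommGroup V] [InnerProductSpace ℝ V]
variable {P : RootPairing ι ℝ V V} {b : P.Base} {ξ : ι}

/-- The lattice `N Q^∨`. -/
def scaledCorootLattice (P : RootPairing ι ℝ V V) (N : ℕ) : AddSubgroup V :=
  (P.corootSpan ℤ).toAddSubgroup.map (nsmulAddMonoidHom N)

lemma mem_scaledCorootLattice {N : ℕ} {x : V} :
    x ∈ scaledCorootLattice P N ↔ ∃ q ∈ P.corootSpan ℤ, (N : ℝ) • q = x := by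
  simp [scaledCorootLattice, Nat.cast_smul_eq_nsmul]

lemma scaledCorootLattice_one : scaledCorootLattice P 1 = (P.corootSpan ℤ).toAddSubgroup := by
  ext x
  simp [mem_scaledCorootLattice]

lemma gramDet_pos (b : P.Base) : 0 < gramDet b := by
  classical
  have h : LinearIndependent ℝ fun i : b.support => P.coroot i := b.linearIndepOn_coroot
  have h₁ : gramDet b = (Matrix.gram ℝ fun i : b.support => P.coroot i).det := by
    unfold gramDet
    congr!
  rw [h₁]
  exact (Matrix.posDef_gram_of_linearIndependent h).det_pos

lemma nondegenerate_inner : (innerₗ V : LinearMap.BilinForm ℝ V).Nondegenerate := by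
  refine ⟨fun x hx => inner_self_eq_zero.1 (hx x), fun x hx => inner_self_eq_zero.1 (hx x)⟩

variable [P.IsRootSystem]

/-- The fundamental weights. -/
def fundamentalWeights (b : P.Base) : Module.Basis b.support ℝ V :=
  open Classical in
  LinearMap.BilinForm.dualBasis (innerₗ V) nondegenerate_inner b.toCoweightBasis

lemma weightLattice_eq_closure (b : P.Base) :
    weightLattice P = AddSubgroup.closure (Set.range (fundamentalWeights b)) := by
  classical
  have h := LinearMap.BilinForm.dualSubmodule_span_of_basis (R := ℤ) (innerₗ V)
    nondegenerate_inner b.toCoweightBasis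
  rw [← corootSpan_eq_span_basis] at h
  rw [← Submodule.span_int_eq_addSubgroupClosure]
  ext x
  rw [Submodule.mem_toAddSubgroup]
  have h' : Submodule.span ℤ (Set.range (fundamentalWeights b)) =
    LinearMap.BilinForm.dualSubmodule (innerₗ V) (P.corootSpan ℤ) := by
    rw [h]
    rfl
  rw [h']
  refine forall₂_congr fun q _ => ?_
  rw [Submodule.mem_one]
  simp [eq_comm]

lemma fundamentalWeights_repr (i : b.support) (x : V) :
    (fundamentalWeights b).repr x i = inner ℝ x (P.coroot i) := by
  classical
  rw [fundamentalWeights, LinearMap.BilinForm.dualBasis_repr_apply]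
  simp

/-- The index of `N Q^∨` in the weight lattice. -/
lemma IsHighestRoot.relIndex_scaledCorootLattice [FiniteDimensional ℝ V] [IsEuclidean P]
    [P.IsCrystallographic] [P.IsIrreducible] (hξ : IsHighestRoot b ξ)
    (hnorm : inner ℝ (P.root ξ) (P.root ξ) = 2)
    {N : ℕ} (hN : 0 < N) :
    ((scaledCorootLattice P N).relIndex (weightLattice P) : ℝ) =
      gramDet b * (N : ℝ) ^ Module.finrank ℝ V := by
  classical
  have hN' : (N : ℝ) ≠ 0 := by positivity
  let v := b.toCoweightBasis.unitsSMul fun _ => Units.mk0 (N : ℝ) hN'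
  have hv : ∀ i, v i = N • P.coroot i := fun i => by
    simp [v, Module.Basis.unitsSMul_apply, Units.smul_def, Nat.cast_smul_eq_nsmul]
  have h₁ : scaledCorootLattice P N = AddSubgroup.closure (Set.range v) := by
    rw [scaledCorootLattice, corootSpan_eq_span_basis b, Submodule.span_int_eq_addSubgroupClosure,
      AddMonoidHom.map_closure]
    congr 1
    ext x
    simp [hv, Set.mem_smul_set]
  have hle : scaledCorootLattice P N ≤ weightLattice P := by
    intro x hx
    obtain ⟨q, hq, rfl⟩ := mem_scaledCorootLattice.1 hx
    rw [Nat.cast_smul_eq_nsmul]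
    exact nsmul_mem (hξ.corootSpan_le_weightLattice hnorm hq) N
  rw [relIndex_eq_abs_det_real _ _ hle v (fundamentalWeights b) h₁ (weightLattice_eq_closure b),
    Module.Basis.det_apply]
  -- Coordinates in the fundamental weights are pairings with the simple coroots, which produces N
  -- times the Gram matrix.
  have h₂ : (fundamentalWeights b).toMatrix v =
      (N : ℝ) • Matrix.of fun i j : b.support => inner ℝ (P.coroot i) (P.coroot j) := by
    ext i j
    rw [Module.Basis.toMatrix_apply, fundamentalWeights_repr, hv, ← Nat.cast_smul_eq_nsmul ℝ,
      real_inner_smul_left, real_inner_comm]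
    simp
  rw [h₂, Matrix.det_smul, Module.finrank_eq_card_basis b.toCoweightBasis]
  change |(N : ℝ) ^ _ * gramDet b| = _
  rw [abs_of_pos (mul_pos (by positivity) (gramDet_pos b)), mul_comm]

end Index

/-! ### Weights modulo N Q^∨ and their Weyl orbits. -/

section Folding

variable {ι V : Type*} [NormedAddCommGroup V] [InnerProductSpace ℝ V]
variable {P : RootPairing ι ℝ V V} {b : P.Base} {ξ : ι}

/-- The weights modulo `N Q^∨`. -/
abbrev WeightQuotient (P : RootPairing ι ℝ V V) (N : ℕ) : Type _ :=
  weightLattice P ⧸ (scaledCorootLattice P N).addSubgroupOf (weightLattice P)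

/-- A representative in `V` of a class of weights modulo `N Q^∨`. -/
def weightRep {N : ℕ} (c : WeightQuotient P N) : V := ((Quotient.out c : weightLattice P) : V)

lemma weightRep_mem {N : ℕ} (c : WeightQuotient P N) : weightRep c ∈ weightLattice P :=
  (Quotient.out c : weightLattice P).2

lemma mk_weightRep {N : ℕ} (c : WeightQuotient P N) :
    (QuotientAddGroup.mk ⟨weightRep c, weightRep_mem c⟩ : WeightQuotient P N) = c :=
  Quotient.out_eq c

lemma sub_weightRep_mem_iff {N : ℕ} (c : WeightQuotient P N) {x : V}
    (hx : x ∈ weightLattice P) :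
    x - weightRep c ∈ scaledCorootLattice P N ↔ c = QuotientAddGroup.mk ⟨x, hx⟩ := by
  rw [← mk_weightRep c, QuotientAddGroup.eq, AddSubgroup.mem_addSubgroupOf, mk_weightRep,
    add_comm]
  simp [sub_eq_add_neg]

lemma smul_mem_scaledCorootLattice [IsEuclidean P] {N : ℕ} (w : P.weylGroup) {x : V}
    (hx : x ∈ scaledCorootLattice P N) : w • x ∈ scaledCorootLattice P N := by
  rw [mem_scaledCorootLattice] at hx ⊢
  obtain ⟨q, hq, rfl⟩ := hx
  exact ⟨w • q, smul_mem_corootSpan w hq, (smul_comm w _ q).symm⟩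

lemma smul_mem_scaledCorootLattice_iff [IsEuclidean P] {N : ℕ} (w : P.weylGroup) {x : V} :
    w • x ∈ scaledCorootLattice P N ↔ x ∈ scaledCorootLattice P N :=
  ⟨fun h => by simpa using smul_mem_scaledCorootLattice w⁻¹ h, smul_mem_scaledCorootLattice w⟩

lemma smul_inv_smul_eq_iff [IsEuclidean P] {N : ℕ} (hN : 0 < N) (g : AffineWeylGroup P) (x : V) :
    g • (N : ℝ)⁻¹ • x = (N : ℝ)⁻¹ • x ↔ (N : ℝ) • (g.left.toAdd : V) = x - g.right • x := by
  have hN' : (N : ℝ) ≠ 0 := by positivity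
  rw [affine_smul_eq, ← (smul_right_injective V hN').eq_iff, smul_add, smul_comm g.right,
    smul_inv_smul₀ hN', smul_inv_smul₀ hN', eq_sub_iff_add_eq, add_comm]

/-- An element fixing x/N is determined by its linear part w, as its translation part must be (x − w
x)/N. -/
lemma stabOrder_eq [IsEuclidean P] {N : ℕ} (hN : 0 < N) (x : V) :
    stabOrder P (N : ℝ) x = Nat.card {w : P.weylGroup // w • x - x ∈ scaledCorootLattice P N} := by
  have hN' : (N : ℝ) ≠ 0 := by positivity
  refine Nat.card_congr (Equiv.ofBijective (fun g => ⟨g.1.right, ?_⟩) ⟨?_, ?_⟩)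
  · rw [← neg_mem_iff, neg_sub, mem_scaledCorootLattice]
    exact ⟨_, g.1.left.toAdd.2, (smul_inv_smul_eq_iff hN _ _).1 g.2⟩
  · rintro ⟨g, hg⟩ ⟨h, hh⟩ hgh
    simp only [Subtype.mk.injEq] at hgh
    have h₁ := (smul_inv_smul_eq_iff hN _ _).1 hg
    rw [hgh, ← (smul_inv_smul_eq_iff hN _ _).1 hh] at h₁
    exact Subtype.ext (SemidirectProduct.ext (Multiplicative.toAdd.injective
      (Subtype.ext (smul_right_injective V hN' h₁))) hgh)
  · rintro ⟨w, hw⟩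
    rw [← neg_mem_iff, neg_sub, mem_scaledCorootLattice] at hw
    obtain ⟨q, hq, h⟩ := hw
    exact ⟨⟨⟨.ofAdd ⟨q, hq⟩, w⟩, (smul_inv_smul_eq_iff hN _ _).2 h⟩, rfl⟩

lemma stabOrder_pos [Finite ι] [P.IsRootSystem] [IsEuclidean P] {N : ℕ} (hN : 0 < N) (x : V) :
    0 < stabOrder P (N : ℝ) x := by
  rw [stabOrder_eq hN]
  have : Nonempty {w : P.weylGroup // w • x - x ∈ scaledCorootLattice P N} :=
    ⟨⟨1, by simp⟩⟩
  exact Nat.card_pos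

variable [FiniteDimensional ℝ V] [P.IsRootSystem] [IsEuclidean P] [P.IsCrystallographic]
  [P.IsIrreducible]

lemma IsHighestRoot.card_weightQuotient (hξ : IsHighestRoot b ξ)
    (hnorm : inner ℝ (P.root ξ) (P.root ξ) = 2) {N : ℕ} (hN : 0 < N) :
    (Nat.card (WeightQuotient P N) : ℝ) = gramDet b * (N : ℝ) ^ Module.finrank ℝ V :=
  hξ.relIndex_scaledCorootLattice hnorm hN

lemma IsHighestRoot.finite_weightQuotient (hξ : IsHighestRoot b ξ)
    (hnorm : inner ℝ (P.root ξ) (P.root ξ) = 2) {N : ℕ} (hN : 0 < N) :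
    Finite (WeightQuotient P N) := by
  refine Nat.finite_of_card_ne_zero fun h => ?_
  have := hξ.card_weightQuotient hnorm hN
  rw [h, Nat.cast_zero] at this
  exact (mul_pos (gramDet_pos b) (by positivity)).ne this

variable [Finite ι]

/-- Moving y/N into F by the affine group, and scaling back by N, stays inside the weights because
Q^∨ ⊆ P. -/
lemma exists_smul_sub_mem (hξ : IsHighestRoot b ξ) (hnorm : inner ℝ (P.root ξ) (P.root ξ) = 2)
    {N : ℕ} (hN : 0 < N) {y : V} (hy : y ∈ weightLattice P) :
    ∃ x ∈ (weightLattice P : Set V) ∩ (N : ℝ) • fundamentalDomain b ξ, ∃ w : P.weylGroup,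
      w • x - y ∈ scaledCorootLattice P N := by
  have hN' : (N : ℝ) ≠ 0 := by positivity
  obtain ⟨g, hg⟩ := exists_smul_mem_fundamentalDomain hξ ((N : ℝ)⁻¹ • y)
  have h₁ : (N : ℝ) • g • (N : ℝ)⁻¹ • y = g.right • y + (N : ℝ) • (g.left.toAdd : V) := by
    rw [affine_smul_eq, smul_add, smul_comm g.right, smul_inv_smul₀ hN']
  refine ⟨_, ⟨?_, Set.smul_mem_smul_set hg⟩, g.right⁻¹, ?_⟩
  · rw [h₁, Nat.cast_smul_eq_nsmul]
    exact add_mem (smul_mem_weightLattice _ hy)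
      (nsmul_mem (hξ.corootSpan_le_weightLattice hnorm g.left.toAdd.2) N)
  · rw [h₁, smul_add, inv_smul_smul, add_sub_cancel_left]
    exact smul_mem_scaledCorootLattice _
      (mem_scaledCorootLattice.2 ⟨_, g.left.toAdd.2, rfl⟩)

variable [P.IsReduced]

/-- A congruence modulo N Q^∨ up to W says that x/N and y/N share an orbit of the affine Weyl group,
which meets F only once. -/
lemma eq_of_smul_sub_mem (hξ : IsHighestRoot b ξ) {N : ℕ} (hN : 0 < N) {x y : V}
    (hx : x ∈ (N : ℝ) • fundamentalDomain b ξ) (hy : y ∈ (N : ℝ) • fundamentalDomain b ξ)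
    {w : P.weylGroup} (h : w • x - y ∈ scaledCorootLattice P N) : x = y := by
  have hN' : (N : ℝ) ≠ 0 := by positivity
  obtain ⟨a, ha, rfl⟩ := hx
  obtain ⟨c, hc, rfl⟩ := hy
  obtain ⟨q, hq, h⟩ := mem_scaledCorootLattice.1 (neg_mem h)
  let g : AffineWeylGroup P := ⟨.ofAdd ⟨q, hq⟩, w⟩
  have hg : g • a = c := by
    change w • a + q = c
    apply smul_right_injective V hN'
    simp only [smul_add, h, smul_comm w]
    abel
  have := smul_eq_of_mem_fundamentalDomain hξ ha (g := g) (hg ▸ hc)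
  simp only
  rw [← hg, this]

lemma IsHighestRoot.finite_weights (hξ : IsHighestRoot b ξ)
    (hnorm : inner ℝ (P.root ξ) (P.root ξ) = 2) {N : ℕ} (hN : 0 < N) :
    ((weightLattice P : Set V) ∩ (N : ℝ) • fundamentalDomain b ξ).Finite := by
  classical
  have := hξ.finite_weightQuotient hnorm hN
  refine Set.Finite.of_injOn (f := fun x => if h : x ∈ weightLattice P then
    (QuotientAddGroup.mk ⟨x, h⟩ : WeightQuotient P N) else 0) (Set.mapsTo_univ _ _) ?_
    Set.finite_univ
  intro x hx y hy hxy
  simp only [dif_pos (show x ∈ weightLattice P from hx.1),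
    dif_pos (show y ∈ weightLattice P from hy.1)] at hxy
  refine (eq_of_smul_sub_mem hξ hN hy.2 hx.2 (w := 1) ?_).symm
  rw [QuotientAddGroup.eq, AddSubgroup.mem_addSubgroupOf] at hxy
  simpa [sub_eq_neg_add] using hxy

/-- Summation over the weights modulo `N Q^∨` of an invariant function. -/
lemma sum_weightRep_eq (hξ : IsHighestRoot b ξ) (hnorm : inner ℝ (P.root ξ) (P.root ξ) = 2)
    {N : ℕ} (hN : 0 < N) [Fintype (WeightQuotient P N)] (f : V → ℂ)
    (hfw : ∀ (w : P.weylGroup) x, f (w • x) = f x)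
    (hfq : ∀ q ∈ scaledCorootLattice P N, ∀ x, f (x + q) = f x) (s : Finset V)
    (hs : ∀ x, x ∈ s ↔ x ∈ (weightLattice P : Set V) ∩ (N : ℝ) • fundamentalDomain b ξ) :
    ∑ c : WeightQuotient P N, f (weightRep c) =
      Fintype.card P.weylGroup * ∑ x ∈ s, f x / stabOrder P (N : ℝ) x := by
  classical
  -- Double counting: each `x` is spread over the |W| elements w, sorted by the class of w x;
  -- invariance makes `f` the same at all of them.
  have h₁ : ∀ x ∈ s, (Fintype.card P.weylGroup : ℂ) * (f x / stabOrder P (N : ℝ) x) =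
      ∑ c : WeightQuotient P N, f (weightRep c) *
        ((Finset.univ.filter fun w : P.weylGroup =>
          w • x - weightRep c ∈ scaledCorootLattice P N).card / stabOrder P (N : ℝ) x) := by
    intro x hx
    have hxP := ((hs x).1 hx).1
    have h₂ : ∀ c : WeightQuotient P N, f (weightRep c) *
        ((Finset.univ.filter fun w : P.weylGroup =>
          w • x - weightRep c ∈ scaledCorootLattice P N).card / stabOrder P (N : ℝ) x) =
        ∑ w : P.weylGroup, if c = QuotientAddGroup.mk ⟨w • x, smul_mem_weightLattice w hxP⟩ then
          f x / stabOrder P (N : ℝ) x else 0 := by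
      intro c
      simp_rw [← sub_weightRep_mem_iff c (smul_mem_weightLattice _ hxP)]
      rw [← Finset.sum_filter, Finset.sum_const, nsmul_eq_mul]
      rcases Finset.eq_empty_or_nonempty (Finset.univ.filter fun w : P.weylGroup =>
          w • x - weightRep c ∈ scaledCorootLattice P N) with h | ⟨w, hw⟩
      · simp [h]
      · have h₃ : f x = f (weightRep c) := by
          rw [← hfw w x, ← hfq _ (Finset.mem_filter.1 hw).2 (weightRep c), add_sub_cancel]
        rw [h₃]
        ring
    rw [Finset.sum_congr rfl fun c _ => h₂ c, Finset.sum_comm]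
    simp
  rw [Finset.mul_sum, Finset.sum_congr rfl h₁, Finset.sum_comm]
  refine Finset.sum_congr rfl fun c _ => ?_
  rw [← Finset.mul_sum]
  -- Exactly one `x₀` in N F has the class `c` in its orbit. The w carrying it there form a coset of
  -- its stabilizer modulo N Q^∨, so the quotient is 1.
  obtain ⟨x₀, hx₀, w₀, hw₀⟩ := exists_smul_sub_mem hξ hnorm hN (weightRep_mem c)
  rw [Finset.sum_eq_single_of_mem x₀ ((hs x₀).2 hx₀), stabOrder_eq hN,
    Nat.card_eq_fintype_card, Fintype.card_subtype]
  · have h₂ : (Finset.univ.filter fun w : P.weylGroup =>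
        w • x₀ - weightRep c ∈ scaledCorootLattice P N).card =
        (Finset.univ.filter fun w : P.weylGroup => w • x₀ - x₀ ∈ scaledCorootLattice P N).card := by
      refine Finset.card_equiv (Equiv.mulLeft w₀⁻¹) fun w => ?_
      simp only [Finset.mem_filter, Finset.mem_univ, true_and, Equiv.coe_mulLeft]
      rw [← smul_mem_scaledCorootLattice_iff w₀ (x := (w₀⁻¹ * w) • x₀ - x₀), smul_sub, ← mul_smul,
        mul_inv_cancel_left, ← add_mem_cancel_right (y := w • x₀ - w₀ • x₀) hw₀]
      simp
    have h₃ : 0 < (Finset.univ.filter fun w : P.weylGroup =>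
        w • x₀ - x₀ ∈ scaledCorootLattice P N).card :=
      Finset.card_pos.2 ⟨1, by simp⟩
    rw [h₂, div_self (by exact_mod_cast h₃.ne'), mul_one]
  · intro x hx hne
    rw [Finset.filter_false_of_mem, Finset.card_empty, Nat.cast_zero, zero_div]
    intro w _ hw
    refine hne (eq_of_smul_sub_mem hξ hN ((hs x).1 hx).2 hx₀.2 (w := w₀⁻¹ * w) ?_)
    rw [← smul_mem_scaledCorootLattice_iff w₀, smul_sub, ← mul_smul, mul_inv_cancel_left]
    have := sub_mem hw hw₀
    rwa [sub_sub_sub_cancel_right] at this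

end Folding

/-! ### Characters of the weights modulo N Q^∨. -/

lemma exp_two_pi_add (x y : ℝ) :
    Complex.exp (2 * Real.pi * Complex.I * ((x + y : ℝ) : ℂ)) =
      Complex.exp (2 * Real.pi * Complex.I * x) * Complex.exp (2 * Real.pi * Complex.I * y) := by
  rw [← Complex.exp_add]
  push_cast
  ring_nf

lemma exp_two_pi_eq_one_iff (x : ℝ) :
    Complex.exp (2 * Real.pi * Complex.I * x) = 1 ↔ ∃ z : ℤ, x = z := by
  rw [Complex.exp_eq_one_iff]
  refine exists_congr fun z => ?_
  have : (2 * Real.pi * Complex.I : ℂ) ≠ 0 := Complex.two_pi_I_ne_zero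
  rw [mul_comm, mul_left_inj' this]
  norm_cast

lemma conj_exp_two_pi (x : ℝ) :
    (starRingEnd ℂ) (Complex.exp (2 * Real.pi * Complex.I * x)) =
      Complex.exp (2 * Real.pi * Complex.I * ((-x : ℝ) : ℂ)) := by
  rw [← Complex.exp_conj]
  simp [map_ofNat]

section Characters

variable {ι V : Type*} [NormedAddCommGroup V] [InnerProductSpace ℝ V]
variable {P : RootPairing ι ℝ V V} {b : P.Base} {ξ : ι}

lemma exists_inner_scaled_eq_int {N : ℕ} (hN : 0 < N) {x q : V} (hx : x ∈ weightLattice P)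
    (hq : q ∈ scaledCorootLattice P N) : ∃ z : ℤ, inner ℝ x ((N : ℝ)⁻¹ • q) = z := by
  have hN' : (N : ℝ) ≠ 0 := by positivity
  obtain ⟨r, hr, rfl⟩ := mem_scaledCorootLattice.1 hq
  rw [inv_smul_smul₀ hN']
  exact hx r hr

/-- The character `μ ↦ exp (2πi ⟨ν, μ⟩ / N)` of the weights modulo `N Q^∨`. -/
def weightChar {N : ℕ} (hN : 0 < N) (n : weightLattice P) : AddChar (WeightQuotient P N) ℂ where
  toFun := Quotient.lift
    (fun m : weightLattice P =>
      Complex.exp (2 * Real.pi * Complex.I * (inner ℝ (n : V) ((N : ℝ)⁻¹ • (m : V)) : ℝ))) (by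
    intro m m' h
    have h₁ := (QuotientAddGroup.leftRel_apply.1 h)
    rw [AddSubgroup.mem_addSubgroupOf] at h₁
    have h₂ : (m' : V) = (m : V) + (((-m + m' : weightLattice P)) : V) := by simp
    rw [h₂, smul_add, inner_add_right, exp_two_pi_add,
      (exp_two_pi_eq_one_iff _).2 (exists_inner_scaled_eq_int hN n.2 h₁), mul_one])
  map_zero_eq_one' := by
    change Complex.exp (2 * Real.pi * Complex.I *
      (inner ℝ (n : V) ((N : ℝ)⁻¹ • ((0 : weightLattice P) : V)) : ℝ)) = 1
    simp
  map_add_eq_mul' := by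
    intro c d
    induction c using QuotientAddGroup.induction_on with | H m =>
    induction d using QuotientAddGroup.induction_on with | H m' =>
    change Complex.exp (2 * Real.pi * Complex.I *
      (inner ℝ (n : V) ((N : ℝ)⁻¹ • ((m + m' : weightLattice P) : V)) : ℝ)) =
      Complex.exp (2 * Real.pi * Complex.I * (inner ℝ (n : V) ((N : ℝ)⁻¹ • (m : V)) : ℝ)) *
      Complex.exp (2 * Real.pi * Complex.I * (inner ℝ (n : V) ((N : ℝ)⁻¹ • (m' : V)) : ℝ))
    rw [← exp_two_pi_add, AddSubgroup.coe_add, smul_add, inner_add_right]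

lemma weightChar_apply {N : ℕ} (hN : 0 < N) (n : weightLattice P) (c : WeightQuotient P N) :
    weightChar hN n c = Complex.exp (2 * Real.pi * Complex.I *
      (inner ℝ (n : V) ((N : ℝ)⁻¹ • weightRep c) : ℝ)) := by
  conv_lhs => rw [← mk_weightRep c]
  rfl

/-- The coroot lattice is the dual of the weight lattice. -/
lemma mem_corootSpan_of_forall_inner [P.IsRootSystem] (b : P.Base) {x : V}
    (hx : ∀ y ∈ weightLattice P, ∃ z : ℤ, inner ℝ x y = z) : x ∈ P.corootSpan ℤ := by
  classical
  rw [corootSpan_eq_span_basis b, Module.Basis.mem_span_iff_repr_mem]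
  intro i
  have h₁ : fundamentalWeights b i ∈ weightLattice P := by
    rw [weightLattice_eq_closure b]
    exact AddSubgroup.subset_closure ⟨i, rfl⟩
  obtain ⟨z, hz⟩ := hx _ h₁
  refine ⟨z, ?_⟩
  rw [real_inner_comm] at hz
  have h₂ : innerₗ V (fundamentalWeights b i) x = b.toCoweightBasis.repr x i := by
    conv_lhs => rw [← b.toCoweightBasis.sum_repr x]
    simp only [map_sum, map_smul, fundamentalWeights, LinearMap.BilinForm.apply_dualBasis_left]
    simp
  rw [← h₂]
  exact hz.symm

/-- Here `0` is the trivial character. Triviality says that n/N pairs integrally with every weight,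
that is, lies in the dual of the weight lattice, which is Q^∨. -/
lemma weightChar_eq_zero_iff [P.IsRootSystem] (b : P.Base) {N : ℕ} (hN : 0 < N)
    (n : weightLattice P) :
    weightChar hN n = 0 ↔ (n : V) ∈ scaledCorootLattice P N := by
  have hN' : (N : ℝ) ≠ 0 := by positivity
  constructor
  · intro h
    refine mem_scaledCorootLattice.2 ⟨(N : ℝ)⁻¹ • (n : V), ?_, smul_inv_smul₀ hN' _⟩
    refine mem_corootSpan_of_forall_inner b fun y hy => ?_
    have h₁ : weightChar hN n (QuotientAddGroup.mk ⟨y, hy⟩) = 1 := by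
      rw [h, AddChar.zero_apply]
    have h₂ := (exp_two_pi_eq_one_iff _).1 h₁
    simpa only [real_inner_smul_left, real_inner_smul_right] using h₂
  · intro h
    ext c
    rw [weightChar_apply, AddChar.zero_apply, exp_two_pi_eq_one_iff]
    obtain ⟨z, hz⟩ := exists_inner_scaled_eq_int hN (weightRep_mem c) h
    refine ⟨z, ?_⟩
    rw [real_inner_smul_right] at hz ⊢
    rw [real_inner_comm, hz]

open Classical in
lemma sum_exp_inner_weightRep [P.IsRootSystem] (b : P.Base) {N : ℕ} (hN : 0 < N)
    [Fintype (WeightQuotient P N)] {n : V} (hn : n ∈ weightLattice P) :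
    ∑ c : WeightQuotient P N, Complex.exp (2 * Real.pi * Complex.I *
      (inner ℝ n ((N : ℝ)⁻¹ • weightRep c) : ℝ)) =
      if n ∈ scaledCorootLattice P N then (Nat.card (WeightQuotient P N) : ℂ) else 0 := by
  have h := AddChar.sum_eq_ite (weightChar hN ⟨n, hn⟩)
  simp only [weightChar_apply, weightChar_eq_zero_iff b] at h
  rw [h, Nat.card_eq_fintype_card]

end Characters

/-! ### Orbit functions: symmetries and orthogonality. -/

section OrbitFunctions

variable {ι V : Type*} [NormedAddCommGroup V] [InnerProductSpace ℝ V]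
variable {P : RootPairing ι ℝ V V} {b : P.Base} {ξ : ι} (σ : P.weylGroup →* ℤˣ)

lemma sign_mul_self (w : P.weylGroup) : ((σ w : ℤ) : ℂ) * ((σ w : ℤ) : ℂ) = 1 := by
  rcases Int.units_eq_one_or (σ w) with h | h <;> simp [h]

variable [Finite ι] [P.IsRootSystem]

lemma conj_orbitFunction (l a : V) :
    (starRingEnd ℂ) (orbitFunction σ l a) = orbitFunction σ l (-a) := by
  simp only [orbitFunction, map_sum, map_mul, conj_exp_two_pi, inner_neg_right]
  simp

variable [IsEuclidean P]

lemma orbitFunction_smul (w : P.weylGroup) (l a : V) :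
    orbitFunction σ l (w • a) = ((σ w : ℤ) : ℂ) * orbitFunction σ l a := by
  rw [orbitFunction, orbitFunction, Finset.mul_sum]
  refine (Fintype.sum_equiv (Equiv.mulLeft w) _ _ fun u => ?_).symm
  simp only [Equiv.coe_mulLeft, mul_smul, inner_smul_smul, map_mul, Units.val_mul, Int.cast_mul]
  ring

lemma orbitFunction_add {l : V} (hl : l ∈ weightLattice P) {q : V} (hq : q ∈ P.corootSpan ℤ)
    (a : V) : orbitFunction σ l (a + q) = orbitFunction σ l a := by
  refine Finset.sum_congr rfl fun w _ => ?_
  rw [inner_add_right, exp_two_pi_add,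
    (exp_two_pi_eq_one_iff _).2 (smul_mem_weightLattice w hl q hq), mul_one]

/-- A stabilizing element of sign −1 makes the value equal to its own negative. Hence points outside
F^σ contribute nothing to the sums. -/
lemma orbitFunction_eq_zero {l : V} (hl : l ∈ weightLattice P) {a : V} {g : AffineWeylGroup P}
    (hg : g • a = a) (hσ : σ (retraction P g) ≠ 1) : orbitFunction σ l (-a) = 0 := by
  have h₁ : orbitFunction σ l (-a) = ((σ g.right : ℤ) : ℂ) * orbitFunction σ l (-a) := by
    conv_lhs => rw [← hg, affine_smul_eq, neg_add, ← smul_neg]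
    rw [orbitFunction_add σ hl (neg_mem g.left.toAdd.2), orbitFunction_smul]
  have h₂ : σ g.right = -1 := (Int.units_eq_one_or _).resolve_left hσ
  rw [h₂] at h₁
  simp only [Units.val_neg, Units.val_one, Int.cast_neg, Int.cast_one, neg_mul, one_mul] at h₁
  exact self_eq_neg.1 h₁

lemma orbitFunction_comm (l m : V) : orbitFunction σ l m = orbitFunction σ m l := by
  refine Fintype.sum_equiv (Equiv.inv _) _ _ fun w => ?_
  rw [Equiv.inv_apply, map_inv, Int.units_inv_eq_self, inner_smul_left_eq, real_inner_comm]

variable [FiniteDimensional ℝ V] [P.IsCrystallographic] [P.IsReduced] [P.IsIrreducible]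

/-- Orthogonality of orbit functions on the weights modulo `N Q^∨`. -/
lemma sum_orbitFunction_mul_orbitFunction (hξ : IsHighestRoot b ξ) {N : ℕ} (hN : 0 < N)
    [Fintype (WeightQuotient P N)] {l l' : V} (hl : l ∈ labels b ξ σ N)
    (hl' : l' ∈ labels b ξ σ N) [Decidable (l = l')] :
    ∑ c : WeightQuotient P N, orbitFunction σ l (-((N : ℝ)⁻¹ • weightRep c)) *
        (starRingEnd ℂ) (orbitFunction σ l' (-((N : ℝ)⁻¹ • weightRep c))) =
      if l = l' then (Nat.card (WeightQuotient P N) : ℂ) * Fintype.card P.weylGroup *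
        stabOrder P (N : ℝ) l else 0 := by
  classical
  have hN' : (N : ℝ) ≠ 0 := by positivity
  have hF : ∀ {l}, l ∈ labels b ξ σ N → l ∈ (N : ℝ) • fundamentalDomain b ξ := fun hl =>
    Set.smul_set_mono (fun x hx => hx.1) hl.2
  have h₁ : ∀ c : WeightQuotient P N, orbitFunction σ l (-((N : ℝ)⁻¹ • weightRep c)) *
      (starRingEnd ℂ) (orbitFunction σ l' (-((N : ℝ)⁻¹ • weightRep c))) =
      ∑ w : P.weylGroup, ∑ w' : P.weylGroup, (((σ w : ℤ) : ℂ) * ((σ w' : ℤ) : ℂ)) *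
        Complex.exp (2 * Real.pi * Complex.I *
          (inner ℝ (w' • l' - w • l) ((N : ℝ)⁻¹ • weightRep c) : ℝ)) := by
    intro c
    rw [conj_orbitFunction, orbitFunction, orbitFunction, Finset.sum_mul_sum]
    refine Finset.sum_congr rfl fun w _ => Finset.sum_congr rfl fun w' _ => ?_
    rw [inner_sub_left, sub_eq_neg_add, exp_two_pi_add, neg_neg, inner_neg_right]
    ring
  -- A surviving pair makes l and l' congruent up to W, hence equal; then w⁻¹w' is the linear part
  -- of an element fixing l/N, where σ is trivial, so σ(w)σ(w') = 1.
  have h₂ : ∀ w w' : P.weylGroup, ∑ c : WeightQuotient P N, (((σ w : ℤ) : ℂ) * ((σ w' : ℤ) : ℂ)) *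
        Complex.exp (2 * Real.pi * Complex.I *
          (inner ℝ (w' • l' - w • l) ((N : ℝ)⁻¹ • weightRep c) : ℝ)) =
      if l = l' ∧ (w⁻¹ * w') • l - l ∈ scaledCorootLattice P N then
        (Nat.card (WeightQuotient P N) : ℂ) else 0 := by
    intro w w'
    rw [← Finset.mul_sum, sum_exp_inner_weightRep b hN
      (sub_mem (smul_mem_weightLattice _ hl'.1) (smul_mem_weightLattice _ hl.1))]
    have h₃ : w' • l' - w • l ∈ scaledCorootLattice P N ↔
        (w⁻¹ * w') • l' - l ∈ scaledCorootLattice P N := by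
      rw [← smul_mem_scaledCorootLattice_iff w (x := _ - l), smul_sub, ← mul_smul,
        mul_inv_cancel_left]
    by_cases h : (w⁻¹ * w') • l' - l ∈ scaledCorootLattice P N
    · have hll : l' = l := eq_of_smul_sub_mem hξ hN (hF hl') (hF hl) h
      subst hll
      rw [if_pos (h₃.2 h), if_pos ⟨rfl, h⟩]
      obtain ⟨a, ha, rfl⟩ := hl.2
      obtain ⟨q, hq, hqa⟩ := mem_scaledCorootLattice.1 (neg_mem h)
      have hσ := ha.2 ⟨.ofAdd ⟨q, hq⟩, w⁻¹ * w'⟩ (by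
        rw [MulAction.mem_stabilizer_iff]
        have := (smul_inv_smul_eq_iff hN ⟨.ofAdd ⟨q, hq⟩, w⁻¹ * w'⟩ ((N : ℝ) • a)).2
          (by rw [← neg_sub]; exact hqa)
        rwa [inv_smul_smul₀ hN'] at this)
      have hσ' : σ (w⁻¹ * w') = 1 := hσ
      rw [map_mul, map_inv, inv_mul_eq_one] at hσ'
      rw [← hσ', sign_mul_self, one_mul]
    · rw [if_neg (mt h₃.1 h), mul_zero, if_neg]
      rintro ⟨rfl, h'⟩
      exact h h'
  rw [Finset.sum_congr rfl fun c _ => h₁ c, Finset.sum_comm]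
  simp_rw [Finset.sum_comm (s := (Finset.univ : Finset (WeightQuotient P N))), h₂]
  by_cases hll : l = l'
  · simp only [hll, true_and, if_true]
    have h₃ : ∀ w : P.weylGroup, (∑ w' : P.weylGroup,
        if (w⁻¹ * w') • l' - l' ∈ scaledCorootLattice P N then
          (Nat.card (WeightQuotient P N) : ℂ) else 0) =
        Nat.card (WeightQuotient P N) * stabOrder P (N : ℝ) l' := by
      intro w
      refine (Equiv.sum_comp (Equiv.mulLeft w⁻¹) fun u : P.weylGroup =>
        if u • l' - l' ∈ scaledCorootLattice P N then (Nat.card (WeightQuotient P N) : ℂ) else 0).trans ?_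
      rw [stabOrder_eq hN, Nat.card_eq_fintype_card (α := {w : P.weylGroup // _}),
        Fintype.card_subtype, ← Finset.sum_filter, Finset.sum_const, nsmul_eq_mul, mul_comm]
    rw [Finset.sum_congr rfl fun w _ => h₃ w, Finset.sum_const, nsmul_eq_mul, Finset.card_univ]
    ring
  · simp [hll]

end OrbitFunctions

/-! ### Integrality of the level, symmetry and unitarity. -/

section SMatrix

variable {ι V : Type*} [NormedAddCommGroup V] [InnerProductSpace ℝ V]
variable {P : RootPairing ι ℝ V V} {b : P.Base} {ξ : ι}

lemma labels_subset [IsEuclidean P] {σ : P.weylGroup →* ℤˣ} {M : ℝ} :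
    labels b ξ σ M ⊆ (weightLattice P : Set V) ∩ M • fundamentalDomain b ξ :=
  Set.inter_subset_inter_right _ (Set.smul_set_mono fun _ hx => hx.1)

/-! ### Comarks -/

variable [P.IsRootSystem]

lemma exists_repr_eq_nat {c : V} (hc : c ∈ AddSubmonoid.closure (P.coroot '' (b.support : Set ι)))
    (i : b.support) : ∃ n : ℕ, b.toCoweightBasis.repr c i = n := by
  classical
  induction hc using AddSubmonoid.closure_induction with
  | mem y hy =>
    obtain ⟨j, hj, rfl⟩ := hy
    have := b.toCoweightBasis_repr_coroot ⟨j, hj⟩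
    simp only at this
    rw [this, Finsupp.single_apply]
    split_ifs
    · exact ⟨1, by simp⟩
    · exact ⟨0, by simp⟩
  | zero => exact ⟨0, by simp⟩
  | add y z _ _ hy hz =>
    obtain ⟨m, hm⟩ := hy
    obtain ⟨n, hn⟩ := hz
    exact ⟨m + n, by simp [hm, hn]⟩

variable [IsEuclidean P]

theorem sMatrix_isSymm [Finite ι] (σ : P.weylGroup →* ℤˣ) (k : ℕ) : (sMatrix b ξ σ k).IsSymm := by
  ext l m
  simp only [Matrix.transpose_apply, sMatrix, Matrix.of_apply]
  have h : ∀ (c : ℝ) (x y : V), orbitFunction σ x (-(c • y)) = orbitFunction σ y (-(c • x)) := by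
    intro c x y
    rw [orbitFunction_comm]
    refine Finset.sum_congr rfl fun w _ => ?_
    simp only [← neg_smul]
    rw [smul_comm, real_inner_smul_left, real_inner_smul_right]
  rw [h, mul_right_comm _ (stabOrder P _ (l : V) : ℝ)]

variable [FiniteDimensional ℝ V]

/-- The coroot ξ^∨ = ξ is, up to sign, a natural combination of simple coroots; pairing with a
strictly dominant vector fixes the sign. -/
lemma IsHighestRoot.exists_comark_eq_nat (hξ : IsHighestRoot b ξ)
    (hnorm : inner ℝ (P.root ξ) (P.root ξ) = 2) (i : Option b.support) :
    ∃ n : ℕ, comark b ξ i = n := by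
  rcases i with _ | i
  · exact ⟨1, by simp [comark]⟩
  · rw [comark, ← coroot_eq_root_of_norm hnorm]
    refine exists_repr_eq_nat ((b.coroot_mem_or_neg_mem ξ).resolve_right fun h => ?_) i
    obtain ⟨x, hx⟩ := exists_inner_root_eq b fun _ => 1
    have h₁ : 0 < inner ℝ x (P.root ξ) :=
      inner_posCone_pos (fun i hi => by simp [hx i hi]) hξ.mem_posCone (P.ne_zero ξ)
    have h₂ : ∀ c ∈ AddSubmonoid.closure (P.coroot '' (b.support : Set ι)), 0 ≤ inner ℝ x c := by
      intro c hc
      induction hc using AddSubmonoid.closure_induction with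
      | mem y hy =>
        obtain ⟨i, hi, rfl⟩ := hy
        have := inner_root_self_pos P i
        rw [inner_coroot, hx i hi]
        positivity
      | zero => simp
      | add y z _ _ hy hz => rw [inner_add_right]; exact add_nonneg hy hz
    have h₃ := h₂ _ h
    rw [coroot_eq_root_of_norm hnorm, inner_neg_right] at h₃
    linarith

/-- `qSigma` is real-valued, while the quotient by N Q^∨ needs a positive natural number N. -/
lemma IsHighestRoot.exists_level_eq_nat (hξ : IsHighestRoot b ξ)
    (hnorm : inner ℝ (P.root ξ) (P.root ξ) = 2) (σ : P.weylGroup →* ℤˣ) {k : ℕ} (hk : 0 < k) :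
    ∃ N : ℕ, 0 < N ∧ k + qSigma b ξ σ = N := by
  classical
  choose f hf using hξ.exists_comark_eq_nat hnorm
  refine ⟨k + ∑ i with σ (retraction P (generator b ξ i)) = -1, f i, by omega, ?_⟩
  push_cast
  simp only [← hf]
  rw [qSigma]

/-! ### Unitarity -/

variable [Finite ι] [P.IsCrystallographic] [P.IsReduced] [P.IsIrreducible]

/-- Discrete orthogonality of orbit functions over the labels. -/
lemma IsHighestRoot.sum_labels (hξ : IsHighestRoot b ξ)
    (hnorm : inner ℝ (P.root ξ) (P.root ξ) = 2) (σ : P.weylGroup →* ℤˣ) {N : ℕ} (hN : 0 < N)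
    {M : ℝ} (hM : M = N) [Fintype (labels b ξ σ M)] {l l' : V} (hl : l ∈ labels b ξ σ M)
    (hl' : l' ∈ labels b ξ σ M) [Decidable (l = l')] :
    ∑ m : labels b ξ σ M, orbitFunction σ l (-(M⁻¹ • (m : V))) *
        (starRingEnd ℂ) (orbitFunction σ l' (-(M⁻¹ • (m : V)))) / stabOrder P M (m : V) =
      if l = l' then ((gramDet b * M ^ Module.finrank ℝ V * stabOrder P M l : ℝ) : ℂ) else 0 := by
  classical
  subst hM
  have hN' : (N : ℝ) ≠ 0 := by positivity
  have := hξ.finite_weightQuotient hnorm hN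
  have := Fintype.ofFinite (WeightQuotient P N)
  set f : V → ℂ := fun x => orbitFunction σ l (-((N : ℝ)⁻¹ • x)) *
    (starRingEnd ℂ) (orbitFunction σ l' (-((N : ℝ)⁻¹ • x))) with hf
  have hT := hξ.finite_weights hnorm hN
  have h₁ := sum_weightRep_eq hξ hnorm hN f (fun w x => ?_) (fun q hq x => ?_) hT.toFinset
    fun x => hT.mem_toFinset
  · rw [hf] at h₁
    simp only at h₁
    rw [sum_orbitFunction_mul_orbitFunction σ hξ hN hl hl'] at h₁
    have h₂ : ∑ m : labels b ξ σ N, f m / stabOrder P (N : ℝ) (m : V) =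
        ∑ x ∈ hT.toFinset, f x / stabOrder P (N : ℝ) x := by
      rw [← Finset.sum_subtype (labels b ξ σ N).toFinset (fun x => Set.mem_toFinset)
        fun x => f x / stabOrder P (N : ℝ) x]
      -- The folded sum runs over all weights in N F; those outside N F^σ have a stabilizer element
      -- of sign −1 and drop out.
      refine Finset.sum_subset (fun x hx => hT.mem_toFinset.2
        (labels_subset (Set.mem_toFinset.1 hx))) fun x hx hx' => ?_
      rw [Set.mem_toFinset] at hx'
      obtain ⟨hxP, a, ha, rfl⟩ := hT.mem_toFinset.1 hx
      have h₃ : ¬ ∀ g ∈ MulAction.stabilizer (AffineWeylGroup P) a, σ (retraction P g) = 1 :=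
        fun h => hx' ⟨hxP, a, ⟨ha, h⟩, rfl⟩
      push Not at h₃
      obtain ⟨g, hg, hσ⟩ := h₃
      simp only [hf, inv_smul_smul₀ hN']
      rw [orbitFunction_eq_zero σ hl.1 (MulAction.mem_stabilizer_iff.1 hg) hσ, zero_mul, zero_div]
    have hW : (Fintype.card P.weylGroup : ℂ) ≠ 0 := by
      exact_mod_cast Fintype.card_ne_zero
    replace h₁ := h₁.trans (congrArg (fun t => (Fintype.card P.weylGroup : ℂ) * t) h₂.symm)
    have hc : (Nat.card (WeightQuotient P N) : ℂ) =
        ((gramDet b * (N : ℝ) ^ Module.finrank ℝ V : ℝ) : ℂ) := by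
      rw [← hξ.card_weightQuotient hnorm hN]
      norm_cast
    apply mul_left_cancel₀ hW
    refine h₁.symm.trans ?_
    rw [hc]
    split_ifs
    · push_cast
      ring
    · simp
  · simp only [hf]
    rw [← smul_comm w, ← smul_neg, orbitFunction_smul, orbitFunction_smul, map_mul]
    have : (starRingEnd ℂ) ((σ w : ℤ) : ℂ) = ((σ w : ℤ) : ℂ) := by simp
    rw [this, mul_mul_mul_comm, sign_mul_self, one_mul]
  · obtain ⟨r, hr, rfl⟩ := mem_scaledCorootLattice.1 hq
    simp only [hf]
    rw [smul_add, inv_smul_smul₀ hN', neg_add, orbitFunction_add σ hl.1 (neg_mem hr),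
      orbitFunction_add σ hl'.1 (neg_mem hr)]

lemma I_pow_mul_conj (n : ℕ) : Complex.I ^ n * (starRingEnd ℂ) (Complex.I ^ n) = 1 := by
  rw [map_pow, ← mul_pow, Complex.conj_I, mul_neg, Complex.I_mul_I, neg_neg, one_pow]

theorem IsHighestRoot.sMatrix_mem_unitaryGroup (hξ : IsHighestRoot b ξ)
    (hnorm : inner ℝ (P.root ξ) (P.root ξ) = 2) (σ : P.weylGroup →* ℤˣ) {k : ℕ} (hk : 0 < k)
    [Fintype (labels b ξ σ (k + qSigma b ξ σ))] [DecidableEq (labels b ξ σ (k + qSigma b ξ σ))] :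
    sMatrix b ξ σ k ∈ Matrix.unitaryGroup (labels b ξ σ (k + qSigma b ξ σ)) ℂ := by
  classical
  obtain ⟨N, hN, hM⟩ := hξ.exists_level_eq_nat hnorm σ hk
  have hN' : (0 : ℝ) < N := by positivity
  rw [Matrix.mem_unitaryGroup_iff]
  ext l l'
  have key := hξ.sum_labels hnorm σ hN hM l.2 l'.2
  rw [Matrix.mul_apply, Matrix.one_apply]
  simp only [Matrix.star_apply, sMatrix, Matrix.of_apply]
  generalize (k : ℝ) + qSigma b ξ σ = M at *
  subst hM
  set D := gramDet b * (N : ℝ) ^ Module.finrank ℝ V with hD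
  have hDpos : 0 < D := mul_pos (gramDet_pos b) (by positivity)
  have hpos : ∀ x : V, (0 : ℝ) < stabOrder P (N : ℝ) x := fun x => by
    exact_mod_cast stabOrder_pos hN x
  have h₁ : ∀ m : labels b ξ σ N,
      Complex.I ^ (Nat.card ι / 2) * orbitFunction σ (l : V) (-((N : ℝ)⁻¹ • (m : V))) /
        (Real.sqrt (D * stabOrder P N (l : V) * stabOrder P N (m : V)) : ℝ) *
      star (Complex.I ^ (Nat.card ι / 2) * orbitFunction σ (l' : V) (-((N : ℝ)⁻¹ • (m : V))) /
        (Real.sqrt (D * stabOrder P N (l' : V) * stabOrder P N (m : V)) : ℝ)) =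
      orbitFunction σ (l : V) (-((N : ℝ)⁻¹ • (m : V))) *
        (starRingEnd ℂ) (orbitFunction σ (l' : V) (-((N : ℝ)⁻¹ • (m : V)))) /
        stabOrder P N (m : V) * ((Real.sqrt (D * stabOrder P N (l : V)) *
          Real.sqrt (D * stabOrder P N (l' : V)) : ℝ) : ℂ)⁻¹ := by
    intro m
    -- The two denominators share √h(m), whose square is the weight 1/h(m) required by `sum_labels`.
    have h₂ : (Real.sqrt (D * stabOrder P N (l : V) * stabOrder P N (m : V)) *
        Real.sqrt (D * stabOrder P N (l' : V) * stabOrder P N (m : V)) : ℝ) =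
        stabOrder P N (m : V) * (Real.sqrt (D * stabOrder P N (l : V)) *
          Real.sqrt (D * stabOrder P N (l' : V))) := by
      rw [Real.sqrt_mul (mul_pos hDpos (hpos l)).le, Real.sqrt_mul (mul_pos hDpos (hpos l')).le]
      have := Real.mul_self_sqrt (hpos m).le
      linear_combination (Real.sqrt (D * stabOrder P N (l : V)) *
          Real.sqrt (D * stabOrder P N (l' : V))) * this
    rw [Complex.star_def, map_div₀, Complex.conj_ofReal, div_mul_div_comm, ← Complex.ofReal_mul,
      h₂, map_mul, mul_mul_mul_comm, I_pow_mul_conj, one_mul, Complex.ofReal_mul,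
      div_mul_eq_div_div, div_eq_mul_inv _ (((Real.sqrt _ * Real.sqrt _ : ℝ)) : ℂ)]
    simp
  rw [Finset.sum_congr rfl fun m _ => h₁ m, ← Finset.sum_mul, key]
  by_cases hll : l = l'
  · subst hll
    have h₃ : (0 : ℝ) < D * stabOrder P N (l : V) := mul_pos hDpos (hpos l)
    rw [if_pos rfl, if_pos rfl, Real.mul_self_sqrt h₃.le, mul_inv_cancel₀]
    exact_mod_cast h₃.ne'
  · rw [if_neg (fun h => hll (Subtype.ext h)), if_neg hll, zero_mul]

end SMatrix

/-! ### The determinant character and the Kac–Peterson matrix. -/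

section KacPeterson

variable {ι V : Type*} [NormedAddCommGroup V] [InnerProductSpace ℝ V]
variable {P : RootPairing ι ℝ V V} {b : P.Base} {ξ : ι}

/-! ### The sign of reflections -/

/-- The map is the orthogonal reflection in the hyperplane of the root, with determinant −1 to the
dimension of the root line. -/
lemma detSign_ofIdx [FiniteDimensional ℝ V] [IsEuclidean P] (i : ι) :
    detSign P (RootPairing.weylGroup.ofIdx P i) = -1 := by
  have h₁ : detHom P (RootPairing.weylGroup.ofIdx P i) = -1 := by
    have h₂ : P.reflection i = ((ℝ ∙ P.root i)ᗮ).reflection.toLinearEquiv := by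
      ext x
      rw [reflection_eq]
      change _ = ((ℝ ∙ P.root i)ᗮ).reflection x
      rw [Submodule.reflection_orthogonal_apply, Submodule.reflection_singleton_apply,
        inner_coroot, RCLike.ofReal_real_eq_id, id, ← real_inner_self_eq_norm_sq,
        real_inner_comm x (P.root i)]
      module
    have h₃ : RootPairing.Equiv.weightHom P (RootPairing.Equiv.reflection P i) =
        P.reflection i := LinearEquiv.ext fun x => rfl
    change LinearEquiv.det (RootPairing.Equiv.weightHom P (RootPairing.Equiv.reflection P i)) = -1
    rw [h₃, h₂]
    refine ((ℝ ∙ P.root i)ᗮ).linearEquiv_det_reflection.trans ?_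
    rw [Submodule.orthogonal_orthogonal, finrank_span_singleton (P.ne_zero i), pow_one]
  have h₃ := detSign_eq_det P (RootPairing.weylGroup.ofIdx P i)
  rw [h₁] at h₃
  refine (Int.units_eq_one_or _).resolve_left fun h => ?_
  rw [h] at h₃
  norm_num at h₃

lemma detSign_generator [FiniteDimensional ℝ V] [IsEuclidean P] (i : Option b.support) :
    detSign P (retraction P (generator b ξ i)) = -1 := by
  rcases i with _ | i
  · exact detSign_ofIdx ξ
  · exact detSign_ofIdx (i : ι)

lemma qSigma_detSign [FiniteDimensional ℝ V] [IsEuclidean P] [P.IsRootSystem] (b : P.Base)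
    (ξ : ι) : qSigma b ξ (detSign P) = dualCoxeter b ξ := by
  classical
  rw [qSigma, dualCoxeter, Finset.filter_true_of_mem fun i _ => detSign_generator i]

lemma relIndex_corootSpan [FiniteDimensional ℝ V] [P.IsRootSystem] [IsEuclidean P]
    [P.IsCrystallographic] [P.IsIrreducible] (hξ : IsHighestRoot b ξ)
    (hnorm : inner ℝ (P.root ξ) (P.root ξ) = 2) :
    ((P.corootSpan ℤ).toAddSubgroup.relIndex (weightLattice P) : ℝ) = gramDet b := by
  have := hξ.relIndex_scaledCorootLattice hnorm one_pos
  rwa [scaledCorootLattice_one, Nat.cast_one, one_pow, mul_one] at this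

/-! ### Counting positive roots -/

/-- Negation exchanges positive and nonpositive roots, so the natural-number division is exact. -/
lemma card_div_two [Finite ι] (b : P.Base) : Nat.card ι / 2 = Nat.card {i // b.IsPos i} := by
  classical
  have := Fintype.ofFinite ι
  let := P.indexNeg
  have h : Nat.card {i // b.IsPos i} = Nat.card {i // ¬ b.IsPos i} := by
    refine Nat.card_congr (Equiv.subtypeEquiv (Equiv.neg ι) fun i => ?_)
    rw [Equiv.neg_apply, RootPairing.Base.IsPos.neg_iff_not, not_not]
  have h' := Nat.card_congr (Equiv.sumCompl fun i => b.IsPos i)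
  rw [Nat.card_sum, ← h] at h'
  omega

/-! ### The Weyl vector -/

/-- The reflection r_i permutes the positive roots other than α_i, so their sum is orthogonal to
α_i^∨; what remains is half of ⟨α_i, α_i^∨⟩ = 2. -/
lemma inner_weylVector_coroot [Finite ι] [IsEuclidean P] [P.IsCrystallographic] [P.IsReduced]
    {i : ι} (hi : i ∈ b.support) : inner ℝ (weylVector b) (P.coroot i) = 1 := by
  classical
  have := Fintype.ofFinite ι
  set S : Finset ι := Finset.univ.filter fun j => b.IsPos j with hS
  have hiS : i ∈ S := by simp [hS, RootPairing.Base.isPos_of_mem_support hi]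
  have h₁ : weylVector b = (1 / 2 : ℝ) • ∑ j ∈ S, P.root j := by
    rw [weylVector, finsum_mem_eq_finite_toFinset_sum _ (Set.toFinite _)]
    congr 2
    ext j
    simp [hS]
  have h₂ : P.reflection i (∑ j ∈ S.erase i, P.root j) = ∑ j ∈ S.erase i, P.root j := by
    rw [map_sum]
    have hmem : ∀ j ∈ S.erase i, P.reflectionPerm i j ∈ S.erase i := by
      intro j hj
      obtain ⟨hji, hj⟩ := Finset.mem_erase.1 hj
      have hjpos : b.IsPos j := (Finset.mem_filter.1 hj).2
      have hpos := hjpos.reflectionPerm hi hji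
      refine Finset.mem_erase.2 ⟨fun h => ?_, by simp [hS, hpos]⟩
      have h₃ : j = P.reflectionPerm i i := (P.reflectionPerm i).injective (by rw [h]; simp)
      have h₄ : b.IsPos (P.reflectionPerm i i) := h₃ ▸ hjpos
      exact (RootPairing.Base.IsPos.neg_iff_not b i).1 h₄ (RootPairing.Base.isPos_of_mem_support hi)
    refine Finset.sum_bij' (fun j _ => P.reflectionPerm i j) (fun j _ => P.reflectionPerm i j)
      hmem hmem (fun j _ => by simp) (fun j _ => by simp) fun j _ => ?_
    rw [P.root_reflectionPerm]
  have h₃ : inner ℝ (∑ j ∈ S.erase i, P.root j) (P.coroot i) = 0 := by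
    rw [reflection_eq, sub_eq_self] at h₂
    exact (smul_eq_zero.1 h₂).resolve_right (P.ne_zero i)
  rw [h₁, ← Finset.add_sum_erase S _ hiS, real_inner_smul_left, inner_add_left, h₃,
    real_inner_comm, inner_coroot_root]
  norm_num

variable [Finite ι] [P.IsRootSystem] [IsEuclidean P] [P.IsCrystallographic] [P.IsReduced]

lemma weylVector_mem_weightLattice (b : P.Base) : weylVector b ∈ weightLattice P := by
  intro q hq
  rw [corootSpan_eq_span_basis b] at hq
  induction hq using Submodule.span_induction with
  | mem x hx =>
    obtain ⟨i, rfl⟩ := hx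
    exact ⟨1, by rw [b.toCoweightBasis_apply, inner_weylVector_coroot i.2, Int.cast_one]⟩
  | zero => exact ⟨0, by simp⟩
  | add x y _ _ hx hy =>
    obtain ⟨a, ha⟩ := hx
    obtain ⟨c, hc⟩ := hy
    exact ⟨a + c, by rw [inner_add_right, ha, hc]; push_cast; rfl⟩
  | smul n x _ hx =>
    obtain ⟨a, ha⟩ := hx
    refine ⟨n * a, ?_⟩
    rw [← Int.cast_smul_eq_zsmul ℝ, real_inner_smul_right, ha]
    push_cast
    rfl

/-- Each simple coroot in ξ = ∑ q_i α_i^∨ contributes q_i; the missing 1 is q_0. -/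
lemma inner_weylVector_highest (b : P.Base) (ξ : ι) :
    inner ℝ (weylVector b) (P.root ξ) = dualCoxeter b ξ - 1 := by
  rw [← b.toCoweightBasis.sum_repr (P.root ξ), inner_sum, dualCoxeter, Fintype.sum_option]
  simp only [real_inner_smul_right, b.toCoweightBasis_apply, comark, add_sub_cancel_left]
  exact Finset.sum_congr rfl fun i _ => by rw [inner_weylVector_coroot i.2, mul_one]

variable [FiniteDimensional ℝ V] [P.IsIrreducible]

/-! ### The domain of the sign character -/

/-- A point on a wall is fixed by a generator, of sign −1; a point on no wall has trivial
stabilizer. -/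
lemma fundamentalDomainSigma_detSign (hξ : IsHighestRoot b ξ) :
    fundamentalDomainSigma b ξ (detSign P) = alcove b ξ := by
  ext a
  constructor
  · rintro ⟨ha, hstab⟩ i
    refine (mem_fundamentalDomain_iff.1 ha i).lt_of_ne' fun h => ?_
    have h₁ := hstab (generator b ξ i) (by
      rw [MulAction.mem_stabilizer_iff, generator_smul, h, zero_smul, sub_zero])
    rw [detSign_generator] at h₁
    exact absurd h₁ (by decide)
  · intro ha
    refine ⟨alcove_subset ha, fun g hg => ?_⟩
    rw [MulAction.mem_stabilizer_iff] at hg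
    rw [eq_one_of_smul_mem_alcove hξ ha (g := g) (hg.symm ▸ ha), map_one, map_one]

lemma stabOrder_eq_one (hξ : IsHighestRoot b ξ) {M : ℝ} (hM : M ≠ 0) {x : V}
    (hx : x ∈ labels b ξ (detSign P) M) : stabOrder P M x = 1 := by
  obtain ⟨-, a, ha, rfl⟩ := hx
  rw [fundamentalDomainSigma_detSign hξ] at ha
  simp only [stabOrder, inv_smul_smul₀ hM]
  have : MulAction.stabilizer (AffineWeylGroup P) a = ⊥ := by
    refine (Subgroup.eq_bot_iff_forall _).2 fun g hg => ?_
    rw [MulAction.mem_stabilizer_iff] at hg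
    exact eq_one_of_smul_mem_alcove hξ ha (hg.symm ▸ ha)
  rw [this, Subgroup.card_bot]

lemma mem_labels_detSign_iff (hξ : IsHighestRoot b ξ) {M : ℝ} (hM : 0 < M) {x : V} :
    x ∈ labels b ξ (detSign P) M ↔ x ∈ weightLattice P ∧
      (∀ i ∈ b.support, 0 < inner ℝ x (P.coroot i)) ∧ inner ℝ x (P.root ξ) < M := by
  rw [labels, fundamentalDomainSigma_detSign hξ]
  refine and_congr Iff.rfl ?_
  rw [Set.mem_smul_set_iff_inv_smul_mem₀ hM.ne', mem_alcove_iff]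
  refine and_congr (forall₂_congr fun i _ => ?_) ?_
  · have h := inner_root_self_pos P i
    rw [inner_coroot, real_inner_smul_left, mul_pos_iff_of_pos_left (by positivity),
      mul_pos_iff_of_pos_left (by positivity)]
  · rw [real_inner_smul_left, inv_mul_lt_iff₀ hM, mul_one]

/-- The shift by the Weyl vector maps the integrable weights onto the labels. -/
lemma add_weylVector_mem_labels_iff (hξ : IsHighestRoot b ξ)
    (hnorm : inner ℝ (P.root ξ) (P.root ξ) = 2) {k : ℕ} (hM : 0 < k + dualCoxeter b ξ) {x : V} :
    x + weylVector b ∈ labels b ξ (detSign P) (k + dualCoxeter b ξ) ↔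
      x ∈ integrableWeights b ξ k := by
  rw [mem_labels_detSign_iff hξ hM, add_mem_cancel_right (weylVector_mem_weightLattice b)]
  refine and_congr_right fun hx => and_congr (forall₂_congr fun i hi => ?_) ?_
  · obtain ⟨z, hz⟩ := hx _ (Submodule.subset_span ⟨i, rfl⟩)
    rw [inner_add_left, inner_weylVector_coroot hi, hz]
    norm_cast
    omega
  · obtain ⟨z, hz⟩ := hx _ (Submodule.subset_span ⟨ξ, rfl⟩)
    rw [inner_add_left, inner_weylVector_highest, hz]
    rw [coroot_eq_root_of_norm hnorm] at hz
    rw [hz]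
    -- The shift is g − 1 rather than g, so the bound becomes z < k + 1, which for an integer is z ≤
    -- k.
    have h₁ : (z : ℝ) + (dualCoxeter b ξ - 1) < k + dualCoxeter b ξ ↔ (z : ℝ) < k + 1 := by
      constructor <;> intro h <;> linarith
    rw [h₁]
    norm_cast
    omega

/-- The shift by the Weyl vector, as a bijection. -/
def shiftEquiv (hξ : IsHighestRoot b ξ) (hnorm : inner ℝ (P.root ξ) (P.root ξ) = 2) {k : ℕ}
    (hM : 0 < k + dualCoxeter b ξ) :
    integrableWeights b ξ k ≃ labels b ξ (detSign P) (k + qSigma b ξ (detSign P)) where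
  toFun l := ⟨l + weylVector b, by
    rw [qSigma_detSign]
    exact (add_weylVector_mem_labels_iff hξ hnorm hM).2 l.2⟩
  invFun m := ⟨m - weylVector b, by
    rw [← add_weylVector_mem_labels_iff hξ hnorm hM, sub_add_cancel, ← qSigma_detSign]
    exact m.2⟩
  left_inv l := by simp
  right_inv m := by simp

theorem submatrix_shiftEquiv_eq_kacPeterson (hξ : IsHighestRoot b ξ)
    (hnorm : inner ℝ (P.root ξ) (P.root ξ) = 2) {k : ℕ} (hM : 0 < k + dualCoxeter b ξ) :
    (sMatrix b ξ (detSign P) k).submatrix (shiftEquiv hξ hnorm hM) (shiftEquiv hξ hnorm hM) =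
      kacPeterson b ξ k := by
  ext l m
  have hl := stabOrder_eq_one hξ (by rw [qSigma_detSign]; exact hM.ne')
    (shiftEquiv hξ hnorm hM l).2
  have hm := stabOrder_eq_one hξ (by rw [qSigma_detSign]; exact hM.ne')
    (shiftEquiv hξ hnorm hM m).2
  simp only [Matrix.submatrix_apply, sMatrix, kacPeterson, Matrix.of_apply, hl, hm, Nat.cast_one,
    mul_one, card_div_two b, relIndex_corootSpan hξ hnorm]
  have h₁ : ((shiftEquiv hξ hnorm hM l : V)) = l + weylVector b := rfl
  have h₂ : ((shiftEquiv hξ hnorm hM m : V)) = m + weylVector b := rfl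
  rw [h₁, h₂, qSigma_detSign]
  have hM' := hM
  generalize (k : ℝ) + dualCoxeter b ξ = M at hM' ⊢
  have hd := gramDet_pos b
  -- With trivial stabilizers and d = |P/Q^∨|, the two normalizations differ only in how the square
  -- root is split.
  have h₃ : (gramDet b ^ (-1 / 2 : ℝ)) * (M ^ (-(Module.finrank ℝ V : ℝ) / 2)) =
      (Real.sqrt (gramDet b * M ^ Module.finrank ℝ V))⁻¹ := by
    rw [Real.sqrt_mul hd.le, mul_inv, Real.sqrt_eq_rpow, Real.sqrt_eq_rpow, ← Real.rpow_neg hd.le,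
      ← Real.rpow_natCast, ← Real.rpow_mul hM'.le, ← Real.rpow_neg hM'.le]
    congr 2 <;> ring
  rw [mul_assoc (Complex.I ^ _) ((gramDet b ^ (-1 / 2 : ℝ) : ℝ) : ℂ), ← Complex.ofReal_mul, h₃,
    Complex.ofReal_inv, mul_div_assoc, mul_assoc, div_eq_inv_mul]
  congr 2
  refine Finset.sum_congr rfl fun w _ => ?_
  congr 1
  · rw [← detSign_eq_det]
    norm_cast
  · congr 1
    rw [inner_neg_right, real_inner_smul_right, ← div_eq_inv_mul]
    push_cast
    ring

end KacPeterson

end OrbitFunction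

end

/-! ### The main theorem. -/

theorem mainTheorem2 {ι V : Type*} [Finite ι] [NormedAddCommGroup V] [InnerProductSpace ℝ V]
    [FiniteDimensional ℝ V] (P : RootPairing ι ℝ V V) [P.IsRootSystem] [P.IsCrystallographic]
    [P.IsReduced] [P.IsIrreducible] [OrbitFunction.IsEuclidean P] (b : P.Base) (ξ : ι)
    (hξ : OrbitFunction.IsHighestRoot b ξ) (hnorm : inner ℝ (P.root ξ) (P.root ξ) = 2)
    (k : ℕ) (hk : 0 < k) :
    (∀ σ : P.weylGroup →* ℤˣ,
      (OrbitFunction.labels b ξ σ (k + OrbitFunction.qSigma b ξ σ)).Finite ∧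
      (∀ [Fintype (OrbitFunction.labels b ξ σ (k + OrbitFunction.qSigma b ξ σ))]
        [DecidableEq (OrbitFunction.labels b ξ σ (k + OrbitFunction.qSigma b ξ σ))],
        OrbitFunction.sMatrix b ξ σ k ∈ Matrix.unitaryGroup
          (OrbitFunction.labels b ξ σ (k + OrbitFunction.qSigma b ξ σ)) ℂ) ∧
      (OrbitFunction.sMatrix b ξ σ k).IsSymm) ∧
    ∃ e : OrbitFunction.integrableWeights b ξ k ≃
        OrbitFunction.labels b ξ (OrbitFunction.detSign P)
          (k + OrbitFunction.qSigma b ξ (OrbitFunction.detSign P)),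
      (∀ l, (e l : V) = (l : V) + OrbitFunction.weylVector b) ∧
      (OrbitFunction.sMatrix b ξ (OrbitFunction.detSign P) k).submatrix e e =
        OrbitFunction.kacPeterson b ξ k := by
  refine ⟨fun σ => ⟨?_, hξ.sMatrix_mem_unitaryGroup hnorm σ hk,
    OrbitFunction.sMatrix_isSymm σ k⟩, ?_⟩
  · obtain ⟨N, hN, hM⟩ := hξ.exists_level_eq_nat hnorm σ hk
    rw [hM]
    exact (hξ.finite_weights hnorm hN).subset OrbitFunction.labels_subset
  · obtain ⟨N, hN, hM⟩ := hξ.exists_level_eq_nat hnorm (OrbitFunction.detSign P) hk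
    have hpos : 0 < k + OrbitFunction.dualCoxeter b ξ := by
      rw [← OrbitFunction.qSigma_detSign, hM]
      exact_mod_cast hN
    exact ⟨OrbitFunction.shiftEquiv hξ hnorm hpos, fun _ => rfl,
      OrbitFunction.submatrix_shiftEquiv_eq_kacPeterson hξ hnorm hpos⟩
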